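/- Let $(M,g)$ be a smooth $n$-dimensional Riemannian manifold and let $TM=X\oplus Y$ be a $g$-orthogonal splitting into smooth sub-bundles of ranks $r$ and $s$. Let $f>0$ be a constant and let $g'=g_X\oplus f^{-2}g_Y$, where $g_X,g_Y$ are the restrictions of $g$ to $X,Y$. Let $(e_1,\dots,e_r,e_{r+1},\dots,e_n)$ be a smooth local $g$-orthonormal frame on an open set $U\subseteq M$ with $e_1,\dots,e_r$ sections of $X$ and $e_{r+1},\dots,e_n$ sections of $Y$, and let $c^C_{AB}$ be its structure functions: $[e_A,e_B]=\sum_C c^C_{AB}e_C$. Lowercase Roman indices $i,j,k,l$ run over $1,\dots,r$, Greek indices over $r+1,\dots,n$, capital indices over $1,\dots,n$, and repeated indices are summed over their ranges, whatever their position; $e_A(h)$ is the derivative of the function $h$ along $e_A$. Let $S$ be the scalar curvature of $g'$. Let $S_1$ be the scalar curvature of $M$ (with respect to $g$) restricted to $X$, that is, with $\nabla$ the Levi-Civita connection of $g$, $P_X$ the orthogonal projection onto $X$ and $D=P_X\circ\nabla$, $$S_1=\sum_{i,j} g\bigl(D_{e_i}D_{e_j}e_j-D_{e_j}D_{e_i}e_j-D_{P_X[e_i,e_j]}e_j,\;e_i\bigr),$$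 and define $S_2$ in the same way from $Y$ and the Greek indices. (If $X$ is involutive, $S_1$ is the scalar curvature of its leaves; in general it is taken in the given frame. Likewise for $S_2$.) Then on $U$ $$S_1=2e_k(c^j_{kj})-c^k_{ik}c^j_{ij}-\tfrac12c^i_{kj}c^k_{ij}-\tfrac14c^i_{kj}c^i_{kj},\qquad S_2=2e_\gamma(c^\beta_{\gamma\beta})-c^\gamma_{\alpha\gamma}c^\beta_{\alpha\beta}-\tfrac12c^\alpha_{\gamma\beta}c^\gamma_{\alpha\beta}-\tfrac14c^\alpha_{\gamma\beta}c^\alpha_{\gamma\beta},$$ and $$\begin{aligned}S={}&S_1+f^2S_2-\tfrac14f^4\,c^i_{\gamma\beta}c^i_{\gamma\beta}\\&+\Bigl(2e_\gamma(c^j_{\gamma j})-c^k_{\alpha k}c^j_{\alpha j}-2c^k_{\alpha k}c^\beta_{\alpha\beta}-\tfrac12c^k_{i\beta}c^i_{k\beta}-c^i_{\gamma\beta}c^\gamma_{i\beta}-\tfrac12c^i_{\gamma j}c^i_{\gamma j}\Bigr)f^2\\&+\Bigl(2e_k(c^\beta_{k\beta})-c^\gamma_{i\gamma}c^\beta_{i\beta}-2c^\gamma_{i\gamma}c^j_{ij}-\tfrac12c^\alpha_{\gamma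 j}c^\gamma_{\alpha j}-c^i_{\gamma j}c^\gamma_{ij}-\tfrac12c^\alpha_{k\beta}c^\alpha_{k\beta}\Bigr)\\&-\tfrac14f^{-2}\,c^\alpha_{kj}c^\alpha_{kj}.\end{aligned}$$ -/

import Mathlib

open Bundle Manifold VectorField
open scoped ContDiff Topology

noncomputable section

namespace SubbundleScalar

variable {n : ℕ} {M : Type*} [TopologicalSpace M] [ChartedSpace (EuclideanSpace ℝ (Fin n)) M]
  [IsManifold (𝓡 n) ∞ M]

/-- A smooth Riemannian metric on the smooth `n`-manifold `M` (without boundary). -/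
abbrev SmoothMetric (n : ℕ) (M : Type*) [TopologicalSpace M]
    [ChartedSpace (EuclideanSpace ℝ (Fin n)) M] [IsManifold (𝓡 n) ∞ M] :=
  ContMDiffRiemannianMetric (𝓡 n) ∞ (EuclideanSpace ℝ (Fin n))
    (fun x : M => TangentSpace (𝓡 n) x)

/-! ### The Levi-Civita connection and the scalar curvature in charts -/

/-- The standard basis vector `∂_i` of the model space. -/
abbrev stdVec (i : Fin n) : EuclideanSpace ℝ (Fin n) := EuclideanSpace.single i 1

/-- The metric read in the preferred chart `φ` at `x₀`, at the point `y` of the model space: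
the pullback of `g` under `φ⁻¹`, applied to the vectors `u`, `v`. -/
def chartMetric (g : SmoothMetric n M) (x₀ : M) (y u v : EuclideanSpace ℝ (Fin n)) : ℝ :=
  g.inner ((extChartAt (𝓡 n) x₀).symm y)
    (mfderiv 𝓘(ℝ, EuclideanSpace ℝ (Fin n)) (𝓡 n) (extChartAt (𝓡 n) x₀).symm y u)
    (mfderiv 𝓘(ℝ, EuclideanSpace ℝ (Fin n)) (𝓡 n) (extChartAt (𝓡 n) x₀).symm y v)

/-- The matrix `(g_{ij})` of the metric in the preferred chart at `x₀`. -/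
def chartGram (g : SmoothMetric n M) (x₀ : M) (y : EuclideanSpace ℝ (Fin n)) :
    Matrix (Fin n) (Fin n) ℝ :=
  Matrix.of fun i j => chartMetric g x₀ y (stdVec i) (stdVec j)

/-- The derivative `∂_u (g(v, w))` in the preferred chart at `x₀`, for constant `u`, `v`, `w`. -/
def chartMetricDeriv (g : SmoothMetric n M) (x₀ : M) (y u v w : EuclideanSpace ℝ (Fin n)) : ℝ :=
  fderiv ℝ (fun z => chartMetric g x₀ z v w) y u

/-- The Christoffel symbols in the preferred chart at `x₀`, as a bilinear map:
`Γ(u, v)^k = ½ ∑_l g^{kl} (∂_u g(v, ∂_l) + ∂_v g(u, ∂_l) - ∂_l g(u, v))`. -/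
def chartChristoffel (g : SmoothMetric n M) (x₀ : M) (y u v : EuclideanSpace ℝ (Fin n)) :
    EuclideanSpace ℝ (Fin n) :=
  ∑ k : Fin n, ((1 / 2 : ℝ) * ∑ l : Fin n, (chartGram g x₀ y)⁻¹ k l *
    (chartMetricDeriv g x₀ y u v (stdVec l) + chartMetricDeriv g x₀ y v u (stdVec l)
      - chartMetricDeriv g x₀ y (stdVec l) u v)) • stdVec k

/-- The Riemann curvature tensor `R(u, v) w` in the preferred chart at `x₀`, with the convention
`R(u, v) w = ∇_u ∇_v w - ∇_v ∇_u w - ∇_{[u, v]} w`. -/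
def chartCurvature (g : SmoothMetric n M) (x₀ : M) (y u v w : EuclideanSpace ℝ (Fin n)) :
    EuclideanSpace ℝ (Fin n) :=
  fderiv ℝ (fun z => chartChristoffel g x₀ z v w) y u
    - fderiv ℝ (fun z => chartChristoffel g x₀ z u w) y v
    + chartChristoffel g x₀ y u (chartChristoffel g x₀ y v w)
    - chartChristoffel g x₀ y v (chartChristoffel g x₀ y u w)

/-- The Ricci tensor in the preferred chart at `x₀`: `Ric(v, w)` is the trace of the map
`u ↦ R(u, v) w`. -/
def chartRicci (g : SmoothMetric n M) (x₀ : M) (y v w : EuclideanSpace ℝ (Fin n)) : ℝ :=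
  ∑ i : Fin n, chartCurvature g x₀ y (stdVec i) v w i

/-- The scalar curvature `∑ g^{jk} Ric_{jk}` of the Riemannian metric `g` at the point `x`,
computed in the preferred chart at `x`. -/
def scalarCurvature (g : SmoothMetric n M) (x : M) : ℝ :=
  ∑ j : Fin n, ∑ k : Fin n, (chartGram g x (extChartAt (𝓡 n) x x))⁻¹ j k *
    chartRicci g x (extChartAt (𝓡 n) x x) (stdVec j) (stdVec k)

/-- The Levi-Civita connection of `g`: the value of `∇_V W` at `x`, computed in the preferred chart
at `x` as `D_V W + Γ(V, W)`. -/
def leviCivita (g : SmoothMetric n M) (V W : (x : M) → TangentSpace (𝓡 n) x) (x : M) :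
    TangentSpace (𝓡 n) x :=
  let V' : EuclideanSpace ℝ (Fin n) → EuclideanSpace ℝ (Fin n) :=
    mpullback 𝓘(ℝ, EuclideanSpace ℝ (Fin n)) (𝓡 n) (extChartAt (𝓡 n) x).symm V
  let W' : EuclideanSpace ℝ (Fin n) → EuclideanSpace ℝ (Fin n) :=
    mpullback 𝓘(ℝ, EuclideanSpace ℝ (Fin n)) (𝓡 n) (extChartAt (𝓡 n) x).symm W
  let y : EuclideanSpace ℝ (Fin n) := extChartAt (𝓡 n) x x
  mfderiv 𝓘(ℝ, EuclideanSpace ℝ (Fin n)) (𝓡 n) (extChartAt (𝓡 n) x).symm y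
    (fderiv ℝ W' y (V' y) + chartChristoffel g x y (V' y) (W' y))

/-! ### Orthogonal splittings, rescaled metrics, adapted frames -/

/-- A smooth sub-bundle of rank `r` of the tangent bundle: locally spanned by `r` linearly
independent smooth vector fields. -/
def IsSmoothSubbundle (X : (x : M) → Submodule ℝ (TangentSpace (𝓡 n) x)) (r : ℕ) : Prop :=
  ∀ x₀ : M, ∃ U : Set M, IsOpen U ∧ x₀ ∈ U ∧
    ∃ σ : Fin r → (x : M) → TangentSpace (𝓡 n) x,
      (∀ i, ContMDiffOn (𝓡 n) ((𝓡 n).prod 𝓘(ℝ, EuclideanSpace ℝ (Fin n))) ∞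
        (fun x => TotalSpace.mk' (EuclideanSpace ℝ (Fin n)) x (σ i x)) U) ∧
      ∀ x ∈ U, LinearIndependent ℝ (fun i => σ i x) ∧
        Submodule.span ℝ (Set.range fun i => σ i x) = X x

/-- `TM = X ⊕ Y` is a splitting into smooth sub-bundles of ranks `r` and `s` which are orthogonal
with respect to `g`. -/
structure IsOrthogonalSplitting (g : SmoothMetric n M)
    (X Y : (x : M) → Submodule ℝ (TangentSpace (𝓡 n) x)) (r s : ℕ) : Prop where
  subbundle_left : IsSmoothSubbundle X r
  subbundle_right : IsSmoothSubbundle Y s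
  isCompl (x : M) : IsCompl (X x) (Y x)
  orthogonal (x : M) : ∀ u ∈ X x, ∀ v ∈ Y x, g.inner x u v = 0

/-- `g' = g_X ⊕ (1 / f²) g_Y`. -/
structure IsRescaledMetric (g : SmoothMetric n M)
    (X Y : (x : M) → Submodule ℝ (TangentSpace (𝓡 n) x)) (f : ℝ) (g' : SmoothMetric n M) :
    Prop where
  left (x : M) : ∀ u ∈ X x, ∀ v ∈ X x, g'.inner x u v = g.inner x u v
  right (x : M) : ∀ u ∈ Y x, ∀ v ∈ Y x, g'.inner x u v = (1 / f ^ 2) * g.inner x u v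
  mixed (x : M) : ∀ u ∈ X x, ∀ v ∈ Y x, g'.inner x u v = 0

/-- A smooth local frame `(e_i)_{i ≤ r}, (e_α)_{α ≤ s}` on `U` which is orthonormal for `g` and
adapted to the splitting: the `e_i` are sections of `X`, the `e_α` are sections of `Y`. -/
structure IsAdaptedOrthonormalFrame (g : SmoothMetric n M)
    (X Y : (x : M) → Submodule ℝ (TangentSpace (𝓡 n) x)) {r s : ℕ}
    (e : Fin r ⊕ Fin s → (x : M) → TangentSpace (𝓡 n) x) (U : Set M) : Prop where
  isLocalFrameOn : IsLocalFrameOn (𝓡 n) (EuclideanSpace ℝ (Fin n)) ∞ e U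
  orthonormal : ∀ x ∈ U, ∀ a b, g.inner x (e a x) (e b x) = if a = b then 1 else 0
  mem_left : ∀ x ∈ U, ∀ i, e (Sum.inl i) x ∈ X x
  mem_right : ∀ x ∈ U, ∀ α, e (Sum.inr α) x ∈ Y x

/-! ### Structure functions, and the scalar curvature restricted to a sub-bundle -/

section Frame

variable {ι : Type*} {e : ι → (x : M) → TangentSpace (𝓡 n) x} {U : Set M}

/-- The structure function `c^k_{ij}` of a local frame: `[e_i, e_j] = ∑_k c^k_{ij} e_k`. -/
def structureFunction (he : IsLocalFrameOn (𝓡 n) (EuclideanSpace ℝ (Fin n)) ∞ e U)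
    (k i j : ι) (x : M) : ℝ :=
  he.coeff k x (mlieBracket (𝓡 n) (e i) (e j) x)

/-- The derivative `e_a(h)` of a function `h` along the member `e_a` of a frame. -/
def frameDeriv (e : ι → (x : M) → TangentSpace (𝓡 n) x) (a : ι) (h : M → ℝ) (x : M) : ℝ :=
  mvfderiv (𝓡 n) h x (e a x)

/-- The Christoffel symbol `Γ^k_{ij}` of the Levi-Civita connection of `g` in a local frame:
`∇_{e_i} e_j = ∑_k Γ^k_{ij} e_k`. -/
def frameChristoffel (g : SmoothMetric n M)
    (he : IsLocalFrameOn (𝓡 n) (EuclideanSpace ℝ (Fin n)) ∞ e U) (k i j : ι) (x : M) : ℝ :=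
  he.coeff k x (leviCivita g (e i) (e j) x)

/-- Given an orthonormal local frame `e` and a selection `a : κ → ι` of some of its members, let
`Z` be the sub-bundle spanned by the `e_{a k}`, with orthogonal projection `P`.
This is the scalar curvature of `M` restricted to `Z`, namely
`∑_{i,j} g(D_{e_i} D_{e_j} e_j - D_{e_j} D_{e_i} e_j - D_{P[e_i, e_j]} e_j, e_i)`
(all indices in `κ`), where `D_V W = P ∇_V W` is the projected Levi-Civita connection. It is
written out with `D_{e_i} e_j = ∑_k Γ^k_{ij} e_k` and `P[e_i, e_j] = ∑_k c^k_{ij} e_k`, where `k`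
runs over `κ` only. If `Z` is involutive, `D` is the Levi-Civita connection of the leaves, and
this is the scalar curvature of the leaf; otherwise it is taken with respect to the given frame. -/
def restrictedScalarCurvature {κ : Type*} [Fintype κ] (g : SmoothMetric n M)
    (he : IsLocalFrameOn (𝓡 n) (EuclideanSpace ℝ (Fin n)) ∞ e U) (a : κ → ι) (x : M) : ℝ :=
  let Γ : κ → κ → κ → M → ℝ := fun k i j => frameChristoffel g he (a k) (a i) (a j)
  let c : κ → κ → κ → M → ℝ := fun k i j => structureFunction he (a k) (a i) (a j)
  ∑ i, ∑ j, (frameDeriv e (a i) (Γ i j j) x - frameDeriv e (a j) (Γ i i j) x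
    + ∑ l, (Γ l j j x * Γ i i l x - Γ l i j x * Γ i j l x - c l i j x * Γ i l j x))

end Frame

end SubbundleScalar

end

/-! Put s = 1 on the X-block and s = f on the Y-block. The fields s_a e_a form a g'-orthonormal
frame, and because f is constant their structure functions are (s_a s_b / s_k) c^k_{ab}, with no
derivative of f. It therefore suffices to express the scalar curvature of a metric through the
structure functions of an orthonormal frame.

Vanishing torsion and metric compatibility give the Koszul formula Γ^k_{ij} = ½(c^k_{ij} − c^i_{jk}
+ c^j_{ki}) (`chartConnCoeff_eq`). Curvature as a commutator of covariant derivatives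
(`chartCurvature_eq_nabla`) makes the scalar curvature a double trace in Γ (`scalar_eq`), and the
algebraic identity `sum_koszul_eq` turns this trace into 2e_k(c^j_{kj}) plus quadratic terms. For
indices in one block the Koszul formula involves only structure functions of that block, so the same
identity yields S_1 and S_2.

For g' the derivative term acquires the weight s_k², the quadratic terms s_i², s_j² and (s_k s_j /
s_i)². Splitting every index by block (`sum_rescaled_blocks`) produces S_1, f²S_2 and the mixed
terms with f⁴, f², 1, f⁻². Curvature is defined in the preferred chart, so the geometry is done
there and carried to M by `isChartFrame_chartField` and `structureFunction_eq`. -/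

noncomputable section

namespace SubbundleScalar

/-! ### Families of bilinear maps and their product rule. -/

section BilinearFamily

variable {n : ℕ} {F : Type*} [NormedAddCommGroup F] [NormedSpace ℝ F]

theorem sum_smul_stdVec (v : EuclideanSpace ℝ (Fin n)) : ∑ i, v i • stdVec i = v := by
  have h := (EuclideanSpace.basisFun (Fin n) ℝ).sum_repr v
  simpa only [EuclideanSpace.basisFun_repr, EuclideanSpace.basisFun_apply] using h

theorem linearMap_eq_sum {A : Type*} [AddCommGroup A] [Module ℝ A]
    (L : EuclideanSpace ℝ (Fin n) →ₗ[ℝ] A) (v : EuclideanSpace ℝ (Fin n)) :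
    L v = ∑ i, v i • L (stdVec i) := by
  conv_lhs => rw [← sum_smul_stdVec v]
  simp only [map_sum, map_smul]

theorem bilinear_eq_sum {A : Type*} [AddCommGroup A] [Module ℝ A]
    {B : EuclideanSpace ℝ (Fin n) → EuclideanSpace ℝ (Fin n) → A} (hB : IsBilinearMap ℝ B)
    (v w : EuclideanSpace ℝ (Fin n)) :
    B v w = ∑ i, ∑ j, v i • w j • B (stdVec i) (stdVec j) := by
  have h : ∀ v w, B v w = hB.toLinearMap v w := fun _ _ => rfl
  simp only [h]
  rw [linearMap_eq_sum hB.toLinearMap v, LinearMap.sum_apply]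
  refine Finset.sum_congr rfl fun i _ => ?_
  rw [LinearMap.smul_apply, linearMap_eq_sum (hB.toLinearMap (stdVec i)) w, Finset.smul_sum]

variable {B : EuclideanSpace ℝ (Fin n) → EuclideanSpace ℝ (Fin n) → EuclideanSpace ℝ (Fin n) → F}
  {y : EuclideanSpace ℝ (Fin n)}

/-- The derivative of a family of bilinear maps is bilinear. -/
theorem isBilinearMap_fderiv (hB : ∀ᶠ z in 𝓝 y, IsBilinearMap ℝ (B z))
    (hd : ∀ u v, DifferentiableAt ℝ (fun z => B z u v) y) :
    IsBilinearMap ℝ fun v w => fderiv ℝ (fun z => B z v w) y where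
  add_left u v w := by
    rw [← fderiv_fun_add (hd _ _) (hd _ _)]
    exact Filter.EventuallyEq.fderiv_eq (hB.mono fun z hz => hz.add_left u v w)
  smul_left c v w := by
    rw [← fderiv_fun_const_smul (hd _ _)]
    exact Filter.EventuallyEq.fderiv_eq (hB.mono fun z hz => hz.smul_left c v w)
  add_right u v w := by
    rw [← fderiv_fun_add (hd _ _) (hd _ _)]
    exact Filter.EventuallyEq.fderiv_eq (hB.mono fun z hz => hz.add_right u v w)
  smul_right c v w := by
    rw [← fderiv_fun_const_smul (hd _ _)]
    exact Filter.EventuallyEq.fderiv_eq (hB.mono fun z hz => hz.smul_right c v w)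

/-- The product rule for a family of bilinear maps applied to two vector fields. -/
theorem hasFDerivAt_bilinear (hB : ∀ᶠ z in 𝓝 y, IsBilinearMap ℝ (B z))
    (hd : ∀ u v, DifferentiableAt ℝ (fun z => B z u v) y)
    {V W : EuclideanSpace ℝ (Fin n) → EuclideanSpace ℝ (Fin n)}
    (hV : DifferentiableAt ℝ V y) (hW : DifferentiableAt ℝ W y) :
    DifferentiableAt ℝ (fun z => B z (V z) (W z)) y ∧
      ∀ u, fderiv ℝ (fun z => B z (V z) (W z)) y u
        = fderiv ℝ (fun z => B z (V y) (W y)) y u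
          + B y (fderiv ℝ V y u) (W y) + B y (V y) (fderiv ℝ W y u) := by
  have hcoord : ∀ {V : EuclideanSpace ℝ (Fin n) → EuclideanSpace ℝ (Fin n)},
      DifferentiableAt ℝ V y → ∀ i, HasFDerivAt (fun z => V z i)
        ((EuclideanSpace.proj (𝕜 := ℝ) i).comp (fderiv ℝ V y)) y := fun hV i =>
    (EuclideanSpace.proj (𝕜 := ℝ) i).hasFDerivAt.comp y hV.hasFDerivAt
  have hsum := HasFDerivAt.fun_sum (u := Finset.univ) fun i (_ : i ∈ Finset.univ) =>
    HasFDerivAt.fun_sum (u := Finset.univ) fun j (_ : j ∈ Finset.univ) =>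
    (hcoord hV i).fun_smul ((hcoord hW j).fun_smul (hd (stdVec i) (stdVec j)).hasFDerivAt)
  -- In coordinates the family is a finite sum of products, so differentiability for each pair of
  -- fixed arguments is enough.
  have heq : (fun z => B z (V z) (W z)) =ᶠ[𝓝 y]
      fun z => ∑ i, ∑ j, V z i • W z j • B z (stdVec i) (stdVec j) :=
    hB.mono fun z hz => bilinear_eq_sum hz _ _
  have hmain := hsum.congr_of_eventuallyEq heq
  refine ⟨hmain.differentiableAt, fun u => ?_⟩
  rw [hmain.fderiv, bilinear_eq_sum hB.self_of_nhds (fderiv ℝ V y u),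
    bilinear_eq_sum hB.self_of_nhds (V y),
    bilinear_eq_sum (isBilinearMap_fderiv hB hd) (V y) (W y)]
  simp only [← Finset.sum_add_distrib, sum_apply,
    add_apply, smul_apply,
    ContinuousLinearMap.smulRight_apply, ContinuousLinearMap.comp_apply, smul_add, PiLp.proj_apply]
  refine Finset.sum_congr rfl fun i _ => Finset.sum_congr rfl fun j _ => ?_
  abel

end BilinearFamily

/-! ### Smoothness of the metric in a chart. -/

section ChartMetric

variable {n : ℕ} {M : Type*} [TopologicalSpace M] [ChartedSpace (EuclideanSpace ℝ (Fin n)) M]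
  [IsManifold (𝓡 n) ∞ M]

theorem isBilinearMap_chartMetric (g : SmoothMetric n M) (x₀ : M) (y : EuclideanSpace ℝ (Fin n)) :
    IsBilinearMap ℝ (chartMetric g x₀ y) := by
  let L : EuclideanSpace ℝ (Fin n) →L[ℝ] EuclideanSpace ℝ (Fin n) :=
    mfderiv 𝓘(ℝ, EuclideanSpace ℝ (Fin n)) (𝓡 n) (extChartAt (𝓡 n) x₀).symm y
  let G : EuclideanSpace ℝ (Fin n) →L[ℝ] EuclideanSpace ℝ (Fin n) →L[ℝ] ℝ :=
    g.inner ((extChartAt (𝓡 n) x₀).symm y)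
  change IsBilinearMap ℝ fun u v => G (L u) (L v)
  constructor <;> intros <;> simp

theorem chartMetric_symm (g : SmoothMetric n M) (x₀ : M) (y u v : EuclideanSpace ℝ (Fin n)) :
    chartMetric g x₀ y u v = chartMetric g x₀ y v u :=
  g.symm _ _ _

/-- The tangent map of the smooth inverse chart is smooth; here it is composed with the constant
section u. -/
theorem contMDiffAt_mfderiv_extChartAt_symm (x₀ : M) (u : EuclideanSpace ℝ (Fin n))
    {y : EuclideanSpace ℝ (Fin n)} (hy : y ∈ (extChartAt (𝓡 n) x₀).target) :
    ContMDiffAt 𝓘(ℝ, EuclideanSpace ℝ (Fin n)) (𝓡 n).tangent ∞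
      (fun y => (⟨(extChartAt (𝓡 n) x₀).symm y, mfderiv 𝓘(ℝ, EuclideanSpace ℝ (Fin n)) (𝓡 n)
        (extChartAt (𝓡 n) x₀).symm y u⟩ : TangentBundle (𝓡 n) M)) y := by
  have ho : IsOpen (extChartAt (𝓡 n) x₀).target := isOpen_extChartAt_target x₀
  have : IsManifold (𝓡 n) 1 M := .of_le (n := ∞) (by norm_num)
  have h := (contMDiffOn_extChartAt_symm (I := 𝓡 n) (n := ∞) x₀).contMDiffOn_tangentMapWithin
    (m := ∞) le_rfl ho.uniqueMDiffOn
  have hs : ContMDiffAt 𝓘(ℝ, EuclideanSpace ℝ (Fin n)) 𝓘(ℝ, EuclideanSpace ℝ (Fin n)).tangent ∞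
      (fun z => (⟨z, u⟩ : TangentBundle 𝓘(ℝ, EuclideanSpace ℝ (Fin n))
        (EuclideanSpace ℝ (Fin n)))) y :=
    contMDiffAt_vectorSpace_iff_contDiffAt.2 contDiffAt_const
  have h2 := ((h ⟨y, u⟩ hy).contMDiffAt
    ((ho.preimage (FiberBundle.continuous_proj _ _)).mem_nhds hy)).comp y hs
  refine h2.congr_of_eventuallyEq ?_
  filter_upwards [ho.mem_nhds hy] with z hz
  simp only [Function.comp_apply, tangentMapWithin, mfderivWithin_of_isOpen ho hz]

theorem contDiffOn_chartMetric (g : SmoothMetric n M) (x₀ : M) (u v : EuclideanSpace ℝ (Fin n)) :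
    ContDiffOn ℝ ∞ (fun y => chartMetric g x₀ y u v) (extChartAt (𝓡 n) x₀).target := by
  intro y hy
  have ho : IsOpen (extChartAt (𝓡 n) x₀).target := isOpen_extChartAt_target x₀
  have hb := ((contMDiffOn_extChartAt_symm (I := 𝓡 n) (n := ∞) x₀) y hy).contMDiffAt
    (ho.mem_nhds hy)
  have h : ContMDiffAt 𝓘(ℝ, EuclideanSpace ℝ (Fin n)) ((𝓡 n).prod 𝓘(ℝ)) ∞
      (fun z ↦ TotalSpace.mk' ℝ (E := Bundle.Trivial M ℝ) ((extChartAt (𝓡 n) x₀).symm z)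
        (chartMetric g x₀ z u v)) y := by
    apply ContMDiffAt.clm_bundle_apply₂ (F₁ := EuclideanSpace ℝ (Fin n))
      (F₂ := EuclideanSpace ℝ (Fin n))
    · exact ContMDiffAt.comp y g.contMDiff.contMDiffAt hb
    · exact contMDiffAt_mfderiv_extChartAt_symm x₀ u hy
    · exact contMDiffAt_mfderiv_extChartAt_symm x₀ v hy
  simp only [contMDiffAt_totalSpace] at h
  exact (contMDiffAt_iff_contDiffAt.1 h.2).contDiffWithinAt

end ChartMetric

/-! ### Levi-Civita connection and orthonormal frames in a chart. -/

section ChartFrame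

variable {n : ℕ} {M : Type*} [TopologicalSpace M] [ChartedSpace (EuclideanSpace ℝ (Fin n)) M]
  [IsManifold (𝓡 n) ∞ M]

theorem differentiableAt_chartMetric (g : SmoothMetric n M) (x₀ : M)
    {y : EuclideanSpace ℝ (Fin n)} (hy : y ∈ (extChartAt (𝓡 n) x₀).target)
    (u v : EuclideanSpace ℝ (Fin n)) : DifferentiableAt ℝ (fun z => chartMetric g x₀ z u v) y :=
  ((contDiffOn_chartMetric g x₀ u v).contDiffAt
    ((isOpen_extChartAt_target x₀).mem_nhds hy)).differentiableAt (by norm_num)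

theorem isBilinearMap_fderiv_chartMetric (g : SmoothMetric n M) (x₀ : M)
    {y : EuclideanSpace ℝ (Fin n)} (hy : y ∈ (extChartAt (𝓡 n) x₀).target) :
    IsBilinearMap ℝ fun v w => fderiv ℝ (fun z => chartMetric g x₀ z v w) y :=
  isBilinearMap_fderiv (.of_forall (isBilinearMap_chartMetric g x₀))
    (differentiableAt_chartMetric g x₀ hy)

/-- Twice the Christoffel symbol of the first kind in the preferred chart at `x₀`. -/
def chartKoszul (g : SmoothMetric n M) (x₀ : M) (y u v w : EuclideanSpace ℝ (Fin n)) : ℝ :=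
  chartMetricDeriv g x₀ y u v w + chartMetricDeriv g x₀ y v u w - chartMetricDeriv g x₀ y w u v

theorem isLinearMap_chartKoszul (g : SmoothMetric n M) (x₀ : M)
    {y : EuclideanSpace ℝ (Fin n)} (hy : y ∈ (extChartAt (𝓡 n) x₀).target)
    (u v : EuclideanSpace ℝ (Fin n)) : IsLinearMap ℝ (chartKoszul g x₀ y u v) := by
  let D := (isBilinearMap_fderiv_chartMetric g x₀ hy).toLinearMap
  change IsLinearMap ℝ fun w => D v w u + D u w v - D u v w
  constructor <;> intros <;> simp <;> ring

theorem isBilinearMap_chartKoszul (g : SmoothMetric n M) (x₀ : M)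
    {y : EuclideanSpace ℝ (Fin n)} (hy : y ∈ (extChartAt (𝓡 n) x₀).target)
    (w : EuclideanSpace ℝ (Fin n)) : IsBilinearMap ℝ fun u v => chartKoszul g x₀ y u v w := by
  let D := (isBilinearMap_fderiv_chartMetric g x₀ hy).toLinearMap
  change IsBilinearMap ℝ fun u v => D v w u + D u w v - D u v w
  constructor <;> intros <;> simp <;> ring

theorem isBilinearMap_chartChristoffel (g : SmoothMetric n M) (x₀ : M)
    {y : EuclideanSpace ℝ (Fin n)} (hy : y ∈ (extChartAt (𝓡 n) x₀).target) :
    IsBilinearMap ℝ (chartChristoffel g x₀ y) := by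
  let K := fun w => (isBilinearMap_chartKoszul g x₀ hy w).toLinearMap
  change IsBilinearMap ℝ fun u v => ∑ k : Fin n, ((1 / 2 : ℝ) * ∑ l : Fin n,
    (chartGram g x₀ y)⁻¹ k l * K (stdVec l) u v) • (stdVec k : EuclideanSpace ℝ (Fin n))
  constructor <;> intros <;>
    simp only [map_add, map_smul, LinearMap.add_apply, LinearMap.smul_apply, smul_eq_mul,
      Finset.smul_sum, ← Finset.sum_add_distrib, smul_smul, ← add_smul] <;>
    refine Finset.sum_congr rfl fun k _ => ?_ <;> congr 1 <;>
    simp only [Finset.mul_sum, ← Finset.sum_add_distrib] <;>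
    exact Finset.sum_congr rfl fun l _ => by ring

/-- This is the vanishing of the torsion. -/
theorem chartChristoffel_symm (g : SmoothMetric n M) (x₀ : M) (y u v : EuclideanSpace ℝ (Fin n)) :
    chartChristoffel g x₀ y u v = chartChristoffel g x₀ y v u := by
  have h : ∀ w, chartMetricDeriv g x₀ y w u v = chartMetricDeriv g x₀ y w v u := fun w => by
    simp only [chartMetricDeriv, chartMetric_symm g x₀ _ u v]
  simp only [chartChristoffel, h, add_comm (chartMetricDeriv g x₀ y u v _)]

variable {ι : Type*}

/-- The covariant derivative `∇_V W` in the preferred chart at `x₀`. -/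
def chartNabla (g : SmoothMetric n M) (x₀ : M)
    (V W : EuclideanSpace ℝ (Fin n) → EuclideanSpace ℝ (Fin n)) (y : EuclideanSpace ℝ (Fin n)) :
    EuclideanSpace ℝ (Fin n) :=
  fderiv ℝ W y (V y) + chartChristoffel g x₀ y (V y) (W y)

/-- The connection coefficient `g(∇_{ε_a} ε_b, ε_k)` of a frame in the preferred chart. -/
def chartConnCoeff (g : SmoothMetric n M) (x₀ : M)
    (ε : ι → EuclideanSpace ℝ (Fin n) → EuclideanSpace ℝ (Fin n)) (k a b : ι)
    (y : EuclideanSpace ℝ (Fin n)) : ℝ :=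
  chartMetric g x₀ y (chartNabla g x₀ (ε a) (ε b) y) (ε k y)

/-- The structure function `g([ε_a, ε_b], ε_k)` of a frame in the preferred chart. -/
def chartBracketCoeff (g : SmoothMetric n M) (x₀ : M)
    (ε : ι → EuclideanSpace ℝ (Fin n) → EuclideanSpace ℝ (Fin n)) (k a b : ι)
    (y : EuclideanSpace ℝ (Fin n)) : ℝ :=
  chartMetric g x₀ y (lieBracket ℝ (ε a) (ε b) y) (ε k y)

theorem chartBracketCoeff_eq_sub (g : SmoothMetric n M) (x₀ : M)
    (ε : ι → EuclideanSpace ℝ (Fin n) → EuclideanSpace ℝ (Fin n)) (k a b : ι)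
    (y : EuclideanSpace ℝ (Fin n)) :
    chartBracketCoeff g x₀ ε k a b y
      = chartConnCoeff g x₀ ε k a b y - chartConnCoeff g x₀ ε k b a y := by
  let G := (isBilinearMap_chartMetric g x₀ y).toLinearMap
  have hG : ∀ u v, chartMetric g x₀ y u v = G u v := fun _ _ => rfl
  simp only [chartBracketCoeff, chartConnCoeff, chartNabla, lieBracket_eq, hG, map_sub, map_add,
    LinearMap.sub_apply, LinearMap.add_apply, chartChristoffel_symm g x₀ y (ε b y) (ε a y)]
  ring

variable [Fintype ι] [DecidableEq ι]

/-- A smooth orthonormal frame `ε` for `g` read in the preferred chart at `x₀`, on an open subset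
`T` of the chart target. -/
structure IsChartFrame (g : SmoothMetric n M) (x₀ : M) (T : Set (EuclideanSpace ℝ (Fin n)))
    (ε : ι → EuclideanSpace ℝ (Fin n) → EuclideanSpace ℝ (Fin n)) : Prop where
  isOpen : IsOpen T
  subset : T ⊆ (extChartAt (𝓡 n) x₀).target
  contDiffOn (a : ι) : ContDiffOn ℝ ∞ (ε a) T
  orthonormal : ∀ y ∈ T, ∀ a b, chartMetric g x₀ y (ε a y) (ε b y) = if a = b then 1 else 0
  expansion : ∀ y ∈ T, ∀ v, v = ∑ a, chartMetric g x₀ y v (ε a y) • ε a y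

namespace IsChartFrame

variable {g : SmoothMetric n M} {x₀ : M} {T : Set (EuclideanSpace ℝ (Fin n))}
  {ε : ι → EuclideanSpace ℝ (Fin n) → EuclideanSpace ℝ (Fin n)}
  {y : EuclideanSpace ℝ (Fin n)}

theorem contDiffAt (h : IsChartFrame g x₀ T ε) (hy : y ∈ T) (a : ι) : ContDiffAt ℝ ∞ (ε a) y :=
  (h.contDiffOn a).contDiffAt (h.isOpen.mem_nhds hy)

theorem differentiableAt (h : IsChartFrame g x₀ T ε) (hy : y ∈ T) (a : ι) :
    DifferentiableAt ℝ (ε a) y :=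
  (h.contDiffAt hy a).differentiableAt (by norm_num)

/-- The m-th coordinate of the frame expansion of ∂_k reads δ_{km} = ∑_l g_{kl} ∑_a ε_a^l ε_a^m,
which exhibits a right inverse of the Gram matrix. -/
theorem inv_chartGram (h : IsChartFrame g x₀ T ε) (hy : y ∈ T) (k l : Fin n) :
    (chartGram g x₀ y)⁻¹ k l = ∑ a, ε a y k * ε a y l := by
  have hinv : (chartGram g x₀ y)⁻¹ = Matrix.of fun k l => ∑ a, ε a y k * ε a y l := by
    refine Matrix.inv_eq_right_inv ?_
    ext k m
    have hB := (isBilinearMap_chartMetric g x₀ y)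
    have hlin : ∀ a, chartMetric g x₀ y (stdVec k) (ε a y)
        = ∑ l, ε a y l * chartMetric g x₀ y (stdVec k) (stdVec l) := fun a =>
      linearMap_eq_sum (hB.toLinearMap (stdVec k)) (ε a y)
    have hexp := congrArg (fun v : EuclideanSpace ℝ (Fin n) => v m)
      (h.expansion y hy (stdVec k))
    simp only [hlin, WithLp.ofLp_sum, Finset.sum_apply, WithLp.ofLp_smul, Pi.smul_apply,
      smul_eq_mul, Finset.sum_mul] at hexp
    simp only [Matrix.mul_apply, chartGram, Matrix.of_apply, Finset.mul_sum]
    rw [Finset.sum_comm]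
    calc _ = _ := Finset.sum_congr rfl fun a _ => Finset.sum_congr rfl fun l _ => by ring
      _ = _ := hexp.symm
      _ = _ := by simp [Matrix.one_apply, eq_comm]
  rw [hinv, Matrix.of_apply]

/-- Metric traces can thus be computed in the orthonormal frame. -/
theorem sum_inv_chartGram (h : IsChartFrame g x₀ T ε) (hy : y ∈ T)
    {B : EuclideanSpace ℝ (Fin n) → EuclideanSpace ℝ (Fin n) → ℝ} (hB : IsBilinearMap ℝ B) :
    ∑ j, ∑ k, (chartGram g x₀ y)⁻¹ j k * B (stdVec j) (stdVec k)
      = ∑ a, B (ε a y) (ε a y) := by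
  simp only [h.inv_chartGram hy, bilinear_eq_sum hB (ε _ y), Finset.sum_mul, smul_eq_mul]
  rw [Finset.sum_comm' (t' := Finset.univ) (s' := fun _ => Finset.univ) (by simp)]
  rw [← Finset.sum_comm]
  simp only [Finset.sum_comm (s := (Finset.univ : Finset (Fin n))) (t := (Finset.univ : Finset ι))]
  exact Finset.sum_congr rfl fun a _ => Finset.sum_congr rfl fun l _ =>
    Finset.sum_congr rfl fun m _ => by ring

theorem chartChristoffel_eq (h : IsChartFrame g x₀ T ε) (hy : y ∈ T)
    (u v : EuclideanSpace ℝ (Fin n)) :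
    chartChristoffel g x₀ y u v = ∑ a, (1 / 2 * chartKoszul g x₀ y u v (ε a y)) • ε a y := by
  have hK : ∀ a, chartKoszul g x₀ y u v (ε a y)
      = ∑ l, ε a y l * chartKoszul g x₀ y u v (stdVec l) := fun a =>
    linearMap_eq_sum ((isLinearMap_chartKoszul g x₀ (h.subset hy) u v).mk' _) (ε a y)
  have hε : ∀ a, ε a y = ∑ k, ε a y k • stdVec k := fun a => (sum_smul_stdVec _).symm
  have hc : chartChristoffel g x₀ y u v = ∑ k : Fin n, ((1 / 2 : ℝ) * ∑ l : Fin n,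
    (chartGram g x₀ y)⁻¹ k l * chartKoszul g x₀ y u v (stdVec l)) • stdVec k := rfl
  have hr : ∀ a, (1 / 2 * chartKoszul g x₀ y u v (ε a y)) • ε a y
      = ∑ k, ((1 / 2 * ∑ l, ε a y l * chartKoszul g x₀ y u v (stdVec l)) * ε a y k) •
        stdVec k := fun a => by
    conv_lhs => rw [hK, hε a]
    rw [Finset.smul_sum]
    simp only [smul_smul, sum_smul_stdVec]
  simp only [hr]
  rw [hc, Finset.sum_comm]
  refine Finset.sum_congr rfl fun k _ => ?_
  rw [← Finset.sum_smul]
  congr 1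
  simp only [h.inv_chartGram hy, Finset.sum_mul, Finset.mul_sum]
  rw [Finset.sum_comm]
  exact Finset.sum_congr rfl fun a _ => Finset.sum_congr rfl fun l _ => by ring

/-- Lowering the index cancels the inverse Gram matrix in the definition of the Christoffel symbols.
-/
theorem chartMetric_chartChristoffel (h : IsChartFrame g x₀ T ε) (hy : y ∈ T)
    (u v w : EuclideanSpace ℝ (Fin n)) :
    chartMetric g x₀ y (chartChristoffel g x₀ y u v) w = 1 / 2 * chartKoszul g x₀ y u v w := by
  let G := (isBilinearMap_chartMetric g x₀ y).toLinearMap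
  let K := (isLinearMap_chartKoszul g x₀ (h.subset hy) u v).mk' _
  have hl : G (∑ a, (1 / 2 * K (ε a y)) • ε a y) w
      = ∑ a, 1 / 2 * K (ε a y) * G w (ε a y) := by
    simp only [map_sum, map_smul, LinearMap.sum_apply, LinearMap.smul_apply, smul_eq_mul]
    exact Finset.sum_congr rfl fun a _ => congrArg _ (chartMetric_symm g x₀ y _ _)
  have hw : K w = ∑ a, G w (ε a y) * K (ε a y) := by
    conv_lhs => rw [h.expansion y hy w]
    simp only [map_sum, map_smul, smul_eq_mul]
    rfl
  rw [h.chartChristoffel_eq hy]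
  refine hl.trans (Eq.trans ?_ (congrArg (1 / 2 * ·) hw.symm))
  simp only [Finset.mul_sum]
  exact Finset.sum_congr rfl fun a _ => by ring

theorem differentiableAt_chartChristoffel (h : IsChartFrame g x₀ T ε) (hy : y ∈ T)
    (u v : EuclideanSpace ℝ (Fin n)) :
    DifferentiableAt ℝ (fun z => chartChristoffel g x₀ z u v) y := by
  have hD : ∀ u v w, DifferentiableAt ℝ (fun z => chartMetricDeriv g x₀ z u v w) y := by
    intro u v w
    have h1 := ((contDiffOn_chartMetric g x₀ v w).fderiv_of_isOpen
      (isOpen_extChartAt_target x₀) (m := 1) (by norm_cast)).contDiffAt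
      ((isOpen_extChartAt_target x₀).mem_nhds (h.subset hy))
    exact (h1.differentiableAt (by norm_num)).clm_apply (differentiableAt_const u)
  have hε : ∀ a k, DifferentiableAt ℝ (fun z => ε a z k) y := fun a k =>
    (EuclideanSpace.proj (𝕜 := ℝ) k).differentiableAt.comp y (h.differentiableAt hy a)
  -- The frame expression for g^{kl} avoids differentiating a matrix inverse.
  have hev : (fun z => chartChristoffel g x₀ z u v) =ᶠ[𝓝 y] fun z => ∑ k : Fin n,
      ((1 / 2 : ℝ) * ∑ l : Fin n, (∑ a, ε a z k * ε a z l) *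
      (chartMetricDeriv g x₀ z u v (stdVec l) + chartMetricDeriv g x₀ z v u (stdVec l)
      - chartMetricDeriv g x₀ z (stdVec l) u v)) • stdVec k := by
    filter_upwards [h.isOpen.mem_nhds hy] with z hz
    simp only [chartChristoffel, h.inv_chartGram hz]
  refine DifferentiableAt.congr_of_eventuallyEq ?_ hev
  fun_prop

theorem eventually_isBilinearMap (h : IsChartFrame g x₀ T ε) (hy : y ∈ T) :
    ∀ᶠ z in 𝓝 y, IsBilinearMap ℝ (chartChristoffel g x₀ z) := by
  filter_upwards [h.isOpen.mem_nhds hy] with z hz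
  exact isBilinearMap_chartChristoffel g x₀ (h.subset hz)

/-- The Levi-Civita connection is compatible with the metric. -/
theorem fderiv_chartMetric (h : IsChartFrame g x₀ T ε) (hy : y ∈ T)
    {V W : EuclideanSpace ℝ (Fin n) → EuclideanSpace ℝ (Fin n)}
    (hV : DifferentiableAt ℝ V y) (hW : DifferentiableAt ℝ W y) (u : EuclideanSpace ℝ (Fin n)) :
    fderiv ℝ (fun z => chartMetric g x₀ z (V z) (W z)) y u
      = chartMetric g x₀ y (fderiv ℝ V y u + chartChristoffel g x₀ y u (V y)) (W y)
        + chartMetric g x₀ y (V y) (fderiv ℝ W y u + chartChristoffel g x₀ y u (W y)) := by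
  have hB := isBilinearMap_chartMetric g x₀ y
  rw [(hasFDerivAt_bilinear (.of_forall (isBilinearMap_chartMetric g x₀))
    (differentiableAt_chartMetric g x₀ (h.subset hy)) hV hW).2 u, hB.add_left, hB.add_right,
    chartMetric_symm g x₀ y (V y) (chartChristoffel g x₀ y u (W y)),
    h.chartMetric_chartChristoffel hy, h.chartMetric_chartChristoffel hy]
  have hs : ∀ a b c, chartMetricDeriv g x₀ y a b c = chartMetricDeriv g x₀ y a c b :=
    fun a b c => by simp only [chartMetricDeriv, chartMetric_symm g x₀ _ b c]
  change chartMetricDeriv g x₀ y u (V y) (W y) + _ + _ = _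
  simp only [chartKoszul]
  linarith [hs u (V y) (W y)]

/-- Metric compatibility applied to the locally constant function g(ε_b, ε_k). -/
theorem chartConnCoeff_antisymm (h : IsChartFrame g x₀ T ε) (hy : y ∈ T) (k a b : ι) :
    chartConnCoeff g x₀ ε k a b y = -chartConnCoeff g x₀ ε b a k y := by
  have h1 := h.fderiv_chartMetric hy (h.differentiableAt hy b) (h.differentiableAt hy k) (ε a y)
  have h2 : (fun z => chartMetric g x₀ z (ε b z) (ε k z)) =ᶠ[𝓝 y]
      fun _ => if b = k then 1 else 0 := by
    filter_upwards [h.isOpen.mem_nhds hy] with z hz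
    exact h.orthonormal z hz b k
  rw [h2.fderiv_eq, fderiv_const_apply, zero_apply, chartMetric_symm g x₀ y (ε b y)] at h1
  simp only [chartConnCoeff, chartNabla]
  linarith

/-- The Koszul formula in an orthonormal frame. -/
theorem chartConnCoeff_eq (h : IsChartFrame g x₀ T ε) (hy : y ∈ T) (k a b : ι) :
    chartConnCoeff g x₀ ε k a b y = 1 / 2 * (chartBracketCoeff g x₀ ε k a b y
      - chartBracketCoeff g x₀ ε a b k y + chartBracketCoeff g x₀ ε b k a y) := by
  simp only [chartBracketCoeff_eq_sub]
  -- With brackets written as differences of Γ's, antisymmetry doubles Γ^k_{ab} and cancels the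
  -- other four terms.
  linarith [h.chartConnCoeff_antisymm hy k a b, h.chartConnCoeff_antisymm hy k b a,
    h.chartConnCoeff_antisymm hy b k a]

end IsChartFrame

end ChartFrame

/-! ### Curvature in terms of connection coefficients. -/

section ChartCurvature

variable {n : ℕ} {M : Type*} [TopologicalSpace M] [ChartedSpace (EuclideanSpace ℝ (Fin n)) M]
  [IsManifold (𝓡 n) ∞ M] {ι : Type*} [Fintype ι] [DecidableEq ι]
  {g : SmoothMetric n M} {x₀ : M} {T : Set (EuclideanSpace ℝ (Fin n))}
  {ε : ι → EuclideanSpace ℝ (Fin n) → EuclideanSpace ℝ (Fin n)}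
  {y : EuclideanSpace ℝ (Fin n)}

namespace IsChartFrame

theorem isBilinearMap_chartCurvature (h : IsChartFrame g x₀ T ε) (hy : y ∈ T)
    (u : EuclideanSpace ℝ (Fin n)) : IsBilinearMap ℝ (chartCurvature g x₀ y u) := by
  let D := (isBilinearMap_fderiv (h.eventually_isBilinearMap hy)
    (h.differentiableAt_chartChristoffel hy)).toLinearMap
  let L := (isBilinearMap_chartChristoffel g x₀ (h.subset hy)).toLinearMap
  change IsBilinearMap ℝ fun v w => D v w u - D u w v + L u (L v w) - L v (L u w)
  constructor <;> intros <;>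
    simp only [map_add, map_smul, LinearMap.add_apply, LinearMap.smul_apply, add_apply,
      smul_apply] <;> module

theorem isLinearMap_chartCurvature (h : IsChartFrame g x₀ T ε) (hy : y ∈ T)
    (v w : EuclideanSpace ℝ (Fin n)) : IsLinearMap ℝ fun u => chartCurvature g x₀ y u v w := by
  let D := (isBilinearMap_fderiv (h.eventually_isBilinearMap hy)
    (h.differentiableAt_chartChristoffel hy)).toLinearMap
  let L := (isBilinearMap_chartChristoffel g x₀ (h.subset hy)).toLinearMap
  change IsLinearMap ℝ fun u => D v w u - D u w v + L u (L v w) - L v (L u w)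
  constructor <;> intros <;>
    simp only [map_add, map_smul, LinearMap.add_apply, LinearMap.smul_apply, add_apply,
      smul_apply] <;> module

/-- The trace of an endomorphism does not depend on the basis. -/
theorem chartRicci_eq (h : IsChartFrame g x₀ T ε) (hy : y ∈ T) (v w : EuclideanSpace ℝ (Fin n)) :
    chartRicci g x₀ y v w
      = ∑ a, chartMetric g x₀ y (chartCurvature g x₀ y (ε a y) v w) (ε a y) := by
  let R := (h.isLinearMap_chartCurvature hy v w).mk' _
  let G := (isBilinearMap_chartMetric g x₀ y).toLinearMap
  have h1 : ∀ i : Fin n, R (stdVec i) i = ∑ a, G (R (stdVec i)) (ε a y) * ε a y i := fun i => by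
    have := congrArg (fun v : EuclideanSpace ℝ (Fin n) => v i) (h.expansion y hy (R (stdVec i)))
    simp only [WithLp.ofLp_sum, Finset.sum_apply, WithLp.ofLp_smul, Pi.smul_apply,
      smul_eq_mul] at this
    exact this
  have h2 : ∀ a, G (R (ε a y)) (ε a y) = ∑ i, ε a y i * G (R (stdVec i)) (ε a y) := fun a => by
    rw [linearMap_eq_sum R (ε a y)]
    simp only [map_sum, map_smul, LinearMap.sum_apply, LinearMap.smul_apply, smul_eq_mul]
  change ∑ i, R (stdVec i) i = ∑ a, G (R (ε a y)) (ε a y)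
  simp only [h1, h2]
  rw [Finset.sum_comm]
  exact Finset.sum_congr rfl fun a _ => Finset.sum_congr rfl fun i _ => mul_comm _ _

theorem scalar_eq_sum_chartCurvature (h : IsChartFrame g x₀ T ε) (hy : y ∈ T) :
    ∑ j, ∑ k, (chartGram g x₀ y)⁻¹ j k * chartRicci g x₀ y (stdVec j) (stdVec k)
      = ∑ a, ∑ b, chartMetric g x₀ y
        (chartCurvature g x₀ y (ε a y) (ε b y) (ε b y)) (ε a y) := by
  have hB : IsBilinearMap ℝ (chartRicci g x₀ y) := by
    let G := (isBilinearMap_chartMetric g x₀ y).toLinearMap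
    let R := fun a => (h.isBilinearMap_chartCurvature hy (ε a y)).toLinearMap
    have hR : chartRicci g x₀ y = fun v w => ∑ a, G (R a v w) (ε a y) := by
      funext v w
      exact h.chartRicci_eq hy v w
    rw [hR]
    constructor <;> intros <;>
      simp only [map_add, map_smul, LinearMap.add_apply, LinearMap.smul_apply,
        Finset.sum_add_distrib, Finset.smul_sum]
  rw [h.sum_inv_chartGram hy hB, Finset.sum_comm]
  exact Finset.sum_congr rfl fun b _ => h.chartRicci_eq hy _ _

theorem hasFDerivAt_chartNabla (h : IsChartFrame g x₀ T ε) (hy : y ∈ T) (b d : ι) :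
    DifferentiableAt ℝ (chartNabla g x₀ (ε b) (ε d)) y ∧
      ∀ u, fderiv ℝ (chartNabla g x₀ (ε b) (ε d)) y u
        = fderiv ℝ (fderiv ℝ (ε d)) y u (ε b y) + fderiv ℝ (ε d) y (fderiv ℝ (ε b) y u)
          + (fderiv ℝ (fun z => chartChristoffel g x₀ z (ε b y) (ε d y)) y u
            + chartChristoffel g x₀ y (fderiv ℝ (ε b) y u) (ε d y)
            + chartChristoffel g x₀ y (ε b y) (fderiv ℝ (ε d) y u)) := by
  obtain ⟨h1, h2⟩ := hasFDerivAt_bilinear (h.eventually_isBilinearMap hy)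
    (h.differentiableAt_chartChristoffel hy) (h.differentiableAt hy b) (h.differentiableAt hy d)
  have h3 : DifferentiableAt ℝ (fderiv ℝ (ε d)) y :=
    ((h.contDiffAt hy d).fderiv_right (m := 1) (by norm_cast)).differentiableAt (by norm_num)
  have h4 := h3.hasFDerivAt.clm_apply (h.differentiableAt hy b).hasFDerivAt
  have h5 : HasFDerivAt (chartNabla g x₀ (ε b) (ε d)) _ y := h4.add h1.hasFDerivAt
  refine ⟨h5.differentiableAt, fun u => ?_⟩
  rw [h5.fderiv, add_apply, h2 u]
  simp only [add_apply, ContinuousLinearMap.comp_apply, ContinuousLinearMap.flip_apply]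
  abel

/-- The curvature tensor in terms of covariant derivatives of the members of a frame. -/
theorem chartCurvature_eq_nabla (h : IsChartFrame g x₀ T ε) (hy : y ∈ T) (a b d : ι) :
    chartCurvature g x₀ y (ε a y) (ε b y) (ε d y)
      = chartNabla g x₀ (ε a) (chartNabla g x₀ (ε b) (ε d)) y
        - chartNabla g x₀ (ε b) (chartNabla g x₀ (ε a) (ε d)) y
        - chartNabla g x₀ (lieBracket ℝ (ε a) (ε b)) (ε d) y := by
  -- Symmetry of second derivatives removes D²ε_d from the commutator.
  have hsymm : fderiv ℝ (fderiv ℝ (ε d)) y (ε a y) (ε b y)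
      = fderiv ℝ (fderiv ℝ (ε d)) y (ε b y) (ε a y) :=
    ((h.contDiffAt hy d).isSymmSndFDerivAt (by simp; norm_cast)) _ _
  let L := (isBilinearMap_chartChristoffel g x₀ (h.subset hy)).toLinearMap
  have hL : ∀ u v, chartChristoffel g x₀ y u v = L u v := fun _ _ => rfl
  have hW : ∀ p q, chartNabla g x₀ (ε p) (chartNabla g x₀ (ε q) (ε d)) y
      = fderiv ℝ (chartNabla g x₀ (ε q) (ε d)) y (ε p y)
        + L (ε p y) (fderiv ℝ (ε d) y (ε q y) + L (ε q y) (ε d y)) := fun _ _ => rfl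
  rw [hW, hW, (h.hasFDerivAt_chartNabla hy b d).2, (h.hasFDerivAt_chartNabla hy a d).2, hsymm]
  simp only [chartNabla, chartCurvature, lieBracket_eq, hL, map_add, map_sub, LinearMap.sub_apply]
  abel

theorem eventually_chartNabla_eq (h : IsChartFrame g x₀ T ε) (hy : y ∈ T) (a b : ι) :
    chartNabla g x₀ (ε a) (ε b) =ᶠ[𝓝 y] fun z => ∑ k, chartConnCoeff g x₀ ε k a b z • ε k z := by
  filter_upwards [h.isOpen.mem_nhds hy] with z hz
  exact h.expansion z hz _

theorem differentiableAt_chartConnCoeff (h : IsChartFrame g x₀ T ε) (hy : y ∈ T) (k a b : ι) :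
    DifferentiableAt ℝ (chartConnCoeff g x₀ ε k a b) y :=
  (hasFDerivAt_bilinear (.of_forall (isBilinearMap_chartMetric g x₀))
    (differentiableAt_chartMetric g x₀ (h.subset hy))
    (h.hasFDerivAt_chartNabla hy a b).1 (h.differentiableAt hy k)).1

theorem chartMetric_sum_smul (h : IsChartFrame g x₀ T ε) (hy : y ∈ T) (f : ι → ℝ) (c : ι) :
    chartMetric g x₀ y (∑ l, f l • ε l y) (ε c y) = f c := by
  let G := (isBilinearMap_chartMetric g x₀ y).toLinearMap
  have hG : ∀ u v, chartMetric g x₀ y u v = G u v := fun _ _ => rfl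
  have ho : ∀ l, G (ε l y) (ε c y) = if l = c then 1 else 0 := fun l => h.orthonormal y hy l c
  simp only [hG, map_sum, map_smul, LinearMap.sum_apply, LinearMap.smul_apply, ho, smul_eq_mul]
  simp

/-- Leibniz rule for ∇_{ε_a} applied to ∑_l Γ^l_{bd} ε_l, then paired with ε_c. -/
theorem chartMetric_chartNabla_chartNabla (h : IsChartFrame g x₀ T ε) (hy : y ∈ T)
    (a b d c : ι) :
    chartMetric g x₀ y (chartNabla g x₀ (ε a) (chartNabla g x₀ (ε b) (ε d)) y) (ε c y)
      = fderiv ℝ (chartConnCoeff g x₀ ε c b d) y (ε a y)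
        + ∑ l, chartConnCoeff g x₀ ε l b d y * chartConnCoeff g x₀ ε c a l y := by
  let L := (isBilinearMap_chartChristoffel g x₀ (h.subset hy)).toLinearMap
  let G := (isBilinearMap_chartMetric g x₀ y).toLinearMap
  have hev := h.eventually_chartNabla_eq hy b d
  have hsum := HasFDerivAt.fun_sum (u := Finset.univ) fun l (_ : l ∈ Finset.univ) =>
    (h.differentiableAt_chartConnCoeff hy l b d).hasFDerivAt.fun_smul
      (h.differentiableAt hy l).hasFDerivAt
  have hval : chartNabla g x₀ (ε a) (chartNabla g x₀ (ε b) (ε d)) y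
      = ∑ l, fderiv ℝ (chartConnCoeff g x₀ ε l b d) y (ε a y) • ε l y
        + ∑ l, chartConnCoeff g x₀ ε l b d y • chartNabla g x₀ (ε a) (ε l) y := by
    have h1 : chartNabla g x₀ (ε a) (chartNabla g x₀ (ε b) (ε d)) y
        = fderiv ℝ (chartNabla g x₀ (ε b) (ε d)) y (ε a y)
          + L (ε a y) (chartNabla g x₀ (ε b) (ε d) y) := rfl
    have h2 : ∀ l, chartNabla g x₀ (ε a) (ε l) y
      = fderiv ℝ (ε l) y (ε a y) + L (ε a y) (ε l y) := fun _ => rfl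
    rw [h1, hev.fderiv_eq, hsum.fderiv, hev.self_of_nhds]
    simp only [h2, sum_apply, add_apply, smul_apply, ContinuousLinearMap.smulRight_apply,
      map_sum, map_smul, smul_add, Finset.sum_add_distrib]
    abel
  rw [hval, (isBilinearMap_chartMetric g x₀ y).add_left, h.chartMetric_sum_smul hy]
  congr 1
  change G (∑ l, _) _ = _
  simp only [map_sum, map_smul, LinearMap.sum_apply, LinearMap.smul_apply, smul_eq_mul]
  rfl

/-- The connection is tensorial in its direction, so the bracket may be expanded in the frame at the
point. -/
theorem chartMetric_chartNabla_lieBracket (h : IsChartFrame g x₀ T ε) (hy : y ∈ T)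
    (a b d c : ι) :
    chartMetric g x₀ y (chartNabla g x₀ (lieBracket ℝ (ε a) (ε b)) (ε d) y) (ε c y)
      = ∑ l, chartBracketCoeff g x₀ ε l a b y * chartConnCoeff g x₀ ε c l d y := by
  let L := (isBilinearMap_chartChristoffel g x₀ (h.subset hy)).toLinearMap
  let G := (isBilinearMap_chartMetric g x₀ y).toLinearMap
  let N : EuclideanSpace ℝ (Fin n) →ₗ[ℝ] EuclideanSpace ℝ (Fin n) :=
    (fderiv ℝ (ε d) y : EuclideanSpace ℝ (Fin n) →ₗ[ℝ] EuclideanSpace ℝ (Fin n))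
      + L.flip (ε d y)
  have hexp : lieBracket ℝ (ε a) (ε b) y = ∑ l, chartBracketCoeff g x₀ ε l a b y • ε l y :=
    h.expansion y hy _
  change G (N (lieBracket ℝ (ε a) (ε b) y)) (ε c y) = ∑ l, _ * G (N (ε l y)) (ε c y)
  rw [hexp]
  simp only [map_sum, map_smul, LinearMap.sum_apply, LinearMap.smul_apply, smul_eq_mul]

/-- The scalar curvature in terms of the connection coefficients of an orthonormal frame. -/
theorem scalar_eq (h : IsChartFrame g x₀ T ε) (hy : y ∈ T) :
    ∑ j, ∑ k, (chartGram g x₀ y)⁻¹ j k * chartRicci g x₀ y (stdVec j) (stdVec k)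
      = ∑ i, ∑ j, (fderiv ℝ (chartConnCoeff g x₀ ε i j j) y (ε i y)
        - fderiv ℝ (chartConnCoeff g x₀ ε i i j) y (ε j y)
        + ∑ l, (chartConnCoeff g x₀ ε l j j y * chartConnCoeff g x₀ ε i i l y
          - chartConnCoeff g x₀ ε l i j y * chartConnCoeff g x₀ ε i j l y
          - chartBracketCoeff g x₀ ε l i j y * chartConnCoeff g x₀ ε i l j y)) := by
  rw [h.scalar_eq_sum_chartCurvature hy]
  refine Finset.sum_congr rfl fun i _ => Finset.sum_congr rfl fun j _ => ?_
  let G := (isBilinearMap_chartMetric g x₀ y).toLinearMap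
  have hsub : ∀ u v w z, chartMetric g x₀ y (u - v - w) z
      = chartMetric g x₀ y u z - chartMetric g x₀ y v z - chartMetric g x₀ y w z :=
    fun u v w z => by
      change G (u - v - w) z = G u z - G v z - G w z
      simp only [map_sub, LinearMap.sub_apply]
  rw [h.chartCurvature_eq_nabla hy, hsub, h.chartMetric_chartNabla_chartNabla hy,
    h.chartMetric_chartNabla_chartNabla hy, h.chartMetric_chartNabla_lieBracket hy]
  simp only [Finset.sum_sub_distrib]
  ring

end IsChartFrame

end ChartCurvature

/-! ### Passage between the manifold and its preferred charts. -/

section Transfer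

variable {n : ℕ} {M : Type*} [TopologicalSpace M] [ChartedSpace (EuclideanSpace ℝ (Fin n)) M]
  [IsManifold (𝓡 n) ∞ M]

/-- The vector field `V` read in the preferred chart at `x₀`. -/
def chartField (x₀ : M) (V : (x : M) → TangentSpace (𝓡 n) x) :
    EuclideanSpace ℝ (Fin n) → EuclideanSpace ℝ (Fin n) :=
  mpullback 𝓘(ℝ, EuclideanSpace ℝ (Fin n)) (𝓡 n) (extChartAt (𝓡 n) x₀).symm V

theorem isInvertible_mfderiv_extChartAt_symm {x₀ : M} {y : EuclideanSpace ℝ (Fin n)}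
    (hy : y ∈ (extChartAt (𝓡 n) x₀).target) :
    (mfderiv 𝓘(ℝ, EuclideanSpace ℝ (Fin n)) (𝓡 n)
      (extChartAt (𝓡 n) x₀).symm y).IsInvertible := by
  have : IsManifold (𝓡 n) 1 M := .of_le (n := ∞) (by norm_num)
  have h := isInvertible_mfderivWithin_extChartAt_symm (I := 𝓡 n) hy
  rwa [(𝓡 n).range_eq_univ, mfderivWithin_univ] at h

theorem mfderiv_chartField {x₀ : M} {y : EuclideanSpace ℝ (Fin n)}
    (hy : y ∈ (extChartAt (𝓡 n) x₀).target) (V : (x : M) → TangentSpace (𝓡 n) x) :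
    mfderiv 𝓘(ℝ, EuclideanSpace ℝ (Fin n)) (𝓡 n) (extChartAt (𝓡 n) x₀).symm y (chartField x₀ V y)
      = V ((extChartAt (𝓡 n) x₀).symm y) :=
  (isInvertible_mfderiv_extChartAt_symm hy).self_apply_inverse _

theorem chartMetric_chartField (g : SmoothMetric n M) {x₀ : M} {y : EuclideanSpace ℝ (Fin n)}
    (hy : y ∈ (extChartAt (𝓡 n) x₀).target) (V W : (x : M) → TangentSpace (𝓡 n) x) :
    chartMetric g x₀ y (chartField x₀ V y) (chartField x₀ W y)
      = g.inner ((extChartAt (𝓡 n) x₀).symm y) (V _) (W _) := by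
  rw [chartMetric, mfderiv_chartField hy, mfderiv_chartField hy]

theorem contDiffAt_chartField {x₀ : M} {y : EuclideanSpace ℝ (Fin n)}
    (hy : y ∈ (extChartAt (𝓡 n) x₀).target) {V : (x : M) → TangentSpace (𝓡 n) x}
    (hV : ContMDiffAt (𝓡 n) (𝓡 n).tangent ∞
      (fun x => (⟨x, V x⟩ : TangentBundle (𝓡 n) M)) ((extChartAt (𝓡 n) x₀).symm y)) :
    ContDiffAt ℝ ∞ (chartField x₀ V) y := by
  have : IsManifold (𝓡 n) 1 M := .of_le (n := ∞) (by norm_num)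
  have hb := ((contMDiffOn_extChartAt_symm (I := 𝓡 n) (n := ∞) x₀) y hy).contMDiffAt
    ((isOpen_extChartAt_target x₀).mem_nhds hy)
  exact contMDiffAt_vectorSpace_iff_contDiffAt.1
    (hV.mpullback_vectorField_preimage hb (isInvertible_mfderiv_extChartAt_symm hy) le_rfl)

theorem chartField_mlieBracket {x₀ : M} {y : EuclideanSpace ℝ (Fin n)}
    (hy : y ∈ (extChartAt (𝓡 n) x₀).target) {V W : (x : M) → TangentSpace (𝓡 n) x}
    (hV : ContMDiffAt (𝓡 n) (𝓡 n).tangent ∞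
      (fun x => (⟨x, V x⟩ : TangentBundle (𝓡 n) M)) ((extChartAt (𝓡 n) x₀).symm y))
    (hW : ContMDiffAt (𝓡 n) (𝓡 n).tangent ∞
      (fun x => (⟨x, W x⟩ : TangentBundle (𝓡 n) M)) ((extChartAt (𝓡 n) x₀).symm y)) :
    chartField x₀ (mlieBracket (𝓡 n) V W) y
      = lieBracket ℝ (chartField x₀ V) (chartField x₀ W) y := by
  have : IsManifold (𝓡 n) (minSmoothness ℝ 2) M := .of_le (n := ∞) (by simp; norm_cast)
  have hb := ((contMDiffOn_extChartAt_symm (I := 𝓡 n) (n := ∞) x₀) y hy).contMDiffAt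
    ((isOpen_extChartAt_target x₀).mem_nhds hy)
  have h := mpullback_mlieBracket (hV.mdifferentiableAt (by norm_num))
    (hW.mdifferentiableAt (by norm_num)) hb (by simp; norm_cast)
  refine h.trans ?_
  rw [← mlieBracketWithin_univ, mlieBracketWithin_eq_lieBracketWithin]
  exact congrFun lieBracketWithin_univ y

theorem mfderiv_extChartAt_eq_chartField (x : M) (V : (x : M) → TangentSpace (𝓡 n) x) :
    mfderiv (𝓡 n) 𝓘(ℝ, EuclideanSpace ℝ (Fin n)) (extChartAt (𝓡 n) x) x (V x)
      = chartField x V (extChartAt (𝓡 n) x x) := by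
  have : IsManifold (𝓡 n) 1 M := .of_le (n := ∞) (by norm_num)
  have hy := mem_extChartAt_target (I := 𝓡 n) x
  have h1 := mfderiv_chartField hy V
  have h2 := mfderiv_extChartAt_comp_mfderivWithin_extChartAt_symm (I := 𝓡 n) hy
  rw [(𝓡 n).range_eq_univ, mfderivWithin_univ] at h2
  have h3 := congrArg (fun L => L (chartField x V (extChartAt (𝓡 n) x x))) h2
  have h4 := extChartAt_to_inv (I := 𝓡 n) x
  -- The point φ⁻¹(φ x) equals x only propositionally, and the tangent spaces depend on it;
  -- generalizing the point allows the substitution.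
  have key : ∀ z, z = x →
      (mfderiv (𝓡 n) 𝓘(ℝ, EuclideanSpace ℝ (Fin n)) (extChartAt (𝓡 n) x) z (V z) :
        EuclideanSpace ℝ (Fin n))
      = mfderiv (𝓡 n) 𝓘(ℝ, EuclideanSpace ℝ (Fin n)) (extChartAt (𝓡 n) x) x (V x) := by
    rintro _ rfl
    rfl
  refine (key _ h4).symm.trans ?_
  rw [← h1]
  exact h3

/-- The derivative of a function along a member of a frame, computed in the preferred chart. -/
theorem frameDeriv_eq {ι : Type*} (e : ι → (x : M) → TangentSpace (𝓡 n) x) (a : ι) {h : M → ℝ}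
    {x : M} {H : EuclideanSpace ℝ (Fin n) → ℝ} (hH : DifferentiableAt ℝ H (extChartAt (𝓡 n) x x))
    (hh : h =ᶠ[𝓝 x] H ∘ extChartAt (𝓡 n) x) :
    frameDeriv e a h x
      = fderiv ℝ H (extChartAt (𝓡 n) x x) (chartField x (e a) (extChartAt (𝓡 n) x x)) := by
  have : IsManifold (𝓡 n) 1 M := .of_le (n := ∞) (by norm_num)
  have hφ : MDifferentiableAt (𝓡 n) 𝓘(ℝ, EuclideanSpace ℝ (Fin n)) (extChartAt (𝓡 n) x) x :=
    mdifferentiableAt_extChartAt (mem_chart_source _ x)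
  have h1 := mfderiv_comp x hH.mdifferentiableAt hφ
  have h2 : frameDeriv e a h x
      = mfderiv (𝓡 n) 𝓘(ℝ, ℝ) (H ∘ extChartAt (𝓡 n) x) x (e a x) :=
    congrArg (fun L : EuclideanSpace ℝ (Fin n) →L[ℝ] ℝ => L (e a x)) hh.mfderiv_eq
  rw [h2, h1, mfderiv_eq_fderiv, ← mfderiv_extChartAt_eq_chartField]
  rfl

variable {ι : Type*} [Fintype ι] [DecidableEq ι] {g : SmoothMetric n M}
  {e : ι → (x : M) → TangentSpace (𝓡 n) x} {U : Set M}

theorem coeff_eq_inner (he : IsLocalFrameOn (𝓡 n) (EuclideanSpace ℝ (Fin n)) ∞ e U)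
    (ho : ∀ x ∈ U, ∀ a b, g.inner x (e a x) (e b x) = if a = b then 1 else 0) {x : M} (hx : x ∈ U)
    (k : ι) (v : TangentSpace (𝓡 n) x) : he.coeff k x v = g.inner x v (e k x) := by
  have h : v = ∑ i, (he.toBasisAt hx).repr v i • e i x := by
    simpa using ((he.toBasisAt hx).sum_repr v).symm
  have h1 : he.coeff k x v = (he.toBasisAt hx).repr v k := by simp [IsLocalFrameOn.coeff, hx]
  rw [h1]
  conv_rhs => rw [h]
  simp only [map_sum, map_smul, sum_apply, smul_apply, ho x hx, smul_eq_mul]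
  simp

theorem sum_inner_smul_frame (he : IsLocalFrameOn (𝓡 n) (EuclideanSpace ℝ (Fin n)) ∞ e U)
    (ho : ∀ x ∈ U, ∀ a b, g.inner x (e a x) (e b x) = if a = b then 1 else 0) {x : M} (hx : x ∈ U)
    (v : TangentSpace (𝓡 n) x) : v = ∑ a, g.inner x v (e a x) • e a x := by
  conv_lhs => rw [← (he.toBasisAt hx).sum_repr v]
  refine Finset.sum_congr rfl fun a _ => ?_
  rw [← coeff_eq_inner he ho hx]
  simp [IsLocalFrameOn.coeff, hx]

theorem isChartFrame_chartField (he : IsLocalFrameOn (𝓡 n) (EuclideanSpace ℝ (Fin n)) ∞ e U)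
    (ho : ∀ x ∈ U, ∀ a b, g.inner x (e a x) (e b x) = if a = b then 1 else 0) (hU : IsOpen U)
    (x₀ : M) :
    IsChartFrame g x₀ ((extChartAt (𝓡 n) x₀).target ∩ (extChartAt (𝓡 n) x₀).symm ⁻¹' U)
      (fun a => chartField x₀ (e a)) where
  isOpen := (continuousOn_extChartAt_symm x₀).isOpen_inter_preimage
    (isOpen_extChartAt_target x₀) hU
  subset := Set.inter_subset_left
  contDiffOn a y hy := (contDiffAt_chartField hy.1 (he.contMDiffAt hU hy.2 a)).contDiffWithinAt
  orthonormal y hy a b := by rw [chartMetric_chartField g hy.1, ho _ hy.2]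
  expansion y hy v := by
    let L : EuclideanSpace ℝ (Fin n) →L[ℝ] EuclideanSpace ℝ (Fin n) :=
      mfderiv 𝓘(ℝ, EuclideanSpace ℝ (Fin n)) (𝓡 n) (extChartAt (𝓡 n) x₀).symm y
    have hL : L.IsInvertible := isInvertible_mfderiv_extChartAt_symm hy.1
    -- The expansion is checked on M, after applying the invertible differential of the inverse
    -- chart.
    refine hL.injective ?_
    have h1 := sum_inner_smul_frame he ho hy.2 (L v)
    have h2 : ∀ a, L (chartField x₀ (e a) y) = e a ((extChartAt (𝓡 n) x₀).symm y) := fun a =>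
      mfderiv_chartField hy.1 (e a)
    rw [map_sum]
    simp only [map_smul, h2]
    refine h1.trans (Finset.sum_congr rfl fun a _ => ?_)
    rw [chartMetric, mfderiv_chartField hy.1]
    rfl

theorem structureFunction_eq (he : IsLocalFrameOn (𝓡 n) (EuclideanSpace ℝ (Fin n)) ∞ e U)
    (ho : ∀ x ∈ U, ∀ a b, g.inner x (e a x) (e b x) = if a = b then 1 else 0) (hU : IsOpen U)
    {x₀ : M} {y : EuclideanSpace ℝ (Fin n)} (hy : y ∈ (extChartAt (𝓡 n) x₀).target)
    (hyU : (extChartAt (𝓡 n) x₀).symm y ∈ U) (k i j : ι) :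
    structureFunction he k i j ((extChartAt (𝓡 n) x₀).symm y)
      = chartBracketCoeff g x₀ (fun a => chartField x₀ (e a)) k i j y := by
  rw [structureFunction, coeff_eq_inner he ho hyU, chartBracketCoeff,
    ← chartField_mlieBracket hy (he.contMDiffAt hU hyU i) (he.contMDiffAt hU hyU j),
    chartMetric_chartField g hy]

theorem eventually_structureFunction_eq
    (he : IsLocalFrameOn (𝓡 n) (EuclideanSpace ℝ (Fin n)) ∞ e U)
    (ho : ∀ x ∈ U, ∀ a b, g.inner x (e a x) (e b x) = if a = b then 1 else 0) (hU : IsOpen U)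
    {x : M} (hx : x ∈ U) (k i j : ι) :
    structureFunction he k i j =ᶠ[𝓝 x]
      chartBracketCoeff g x (fun a => chartField x (e a)) k i j ∘ extChartAt (𝓡 n) x := by
  filter_upwards [hU.mem_nhds hx, extChartAt_source_mem_nhds (I := 𝓡 n) x] with z hz hzs
  have h := structureFunction_eq he ho hU ((extChartAt (𝓡 n) x).map_source hzs)
    (by rwa [(extChartAt (𝓡 n) x).left_inv hzs]) k i j
  rwa [(extChartAt (𝓡 n) x).left_inv hzs] at h

theorem frameChristoffel_eq (he : IsLocalFrameOn (𝓡 n) (EuclideanSpace ℝ (Fin n)) ∞ e U)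
    (ho : ∀ x ∈ U, ∀ a b, g.inner x (e a x) (e b x) = if a = b then 1 else 0) (hU : IsOpen U)
    {x : M} (hx : x ∈ U) (k i j : ι) :
    frameChristoffel g he k i j x = 1 / 2 * (structureFunction he k i j x
      - structureFunction he i j k x + structureFunction he j k i x) := by
  have hx' := extChartAt_to_inv (I := 𝓡 n) x
  have hy := mem_extChartAt_target (I := 𝓡 n) x
  have hyU : (extChartAt (𝓡 n) x).symm (extChartAt (𝓡 n) x x) ∈ U := by rwa [hx']
  have hK := (isChartFrame_chartField he ho hU x).chartConnCoeff_eq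
    (y := extChartAt (𝓡 n) x x) ⟨hy, hyU⟩ k i j
  simp only [← structureFunction_eq he ho hU hy hyU, hx'] at hK
  rw [← hK, frameChristoffel, coeff_eq_inner he ho hx, chartConnCoeff, chartMetric,
    mfderiv_chartField hy]
  have key : ∀ (u : EuclideanSpace ℝ (Fin n)) (z : M), z = x →
      (g.inner x : EuclideanSpace ℝ (Fin n) →L[ℝ] EuclideanSpace ℝ (Fin n) →L[ℝ] ℝ) u (e k x)
        = (g.inner z : EuclideanSpace ℝ (Fin n) →L[ℝ] EuclideanSpace ℝ (Fin n) →L[ℝ] ℝ)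
          u (e k z) := by
    rintro u _ rfl
    rfl
  exact key _ _ hx'

end Transfer

/-! ### The algebraic identity behind the frame formula. -/

section Algebra

variable {κ : Type*} [Fintype κ]

theorem sum_cyclic (F : κ → κ → κ → ℝ) :
    ∑ i, ∑ j, ∑ l, F j l i = ∑ i, ∑ j, ∑ l, F i j l := by
  rw [Finset.sum_comm]
  exact Finset.sum_congr rfl fun j _ => Finset.sum_comm

/-- The frame formula for the scalar curvature: if the connection coefficients `Γ` are given by the
Koszul formula in terms of the structure constants `c`, and `δ i j` stands for the derivative of
`c^j_{ij}` along `e_i`, then the double trace of the curvature is expressed by `c` and `δ`. -/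
theorem sum_koszul_eq (c Γ : κ → κ → κ → ℝ) (δ : κ → κ → ℝ) (hc : ∀ k i j, c k i j = -c k j i)
    (hΓ : ∀ k i j, Γ k i j = 1 / 2 * (c k i j - c i j k + c j k i)) :
    ∑ i, ∑ j, (δ i j - -δ j i + ∑ l, (Γ l j j * Γ i i l - Γ l i j * Γ i j l - c l i j * Γ i l j))
      = ∑ k, ∑ j, 2 * δ k j + ∑ i, ∑ j, ∑ k, (-(c k i k * c j i j)
        - 1 / 2 * (c i k j * c k i j) - 1 / 4 * c i k j ^ 2) := by
  have hdiag : ∀ k i, c k i i = 0 := fun k i => by linarith [hc k i i]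
  -- Pointwise normal form. After summation, cyclic relabelling merges the squares to −3/4 + 1/4 +
  -- 1/4 = −1/4 and the cross products to −1/2 + 1/2 + 1/2 = 1/2; the antisymmetry used in `h8` then
  -- makes the latter −1/2.
  have hquad : ∀ i j l, Γ l j j * Γ i i l - Γ l i j * Γ i j l - c l i j * Γ i l j
      = -(c j l j * c i l i) + (-(3 / 4) * c l i j ^ 2 + 1 / 4 * c i j l ^ 2 + 1 / 4 * c j l i ^ 2
        - 1 / 2 * (c i j l * c j l i) + 1 / 2 * (c l i j * c i j l)
        + 1 / 2 * (c j l i * c l i j)) := fun i j l => by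
    simp only [hΓ]
    rw [hdiag l j, hc j j l, hdiag l i, hc i i l, hc i l j, hc l j i, hc j i l]
    ring
  have h1 := sum_cyclic fun i j l => c j l i ^ 2
  have h2 := sum_cyclic fun i j l => c i j l ^ 2
  have h3 := sum_cyclic fun i j l => c j l i * c l i j
  have h4 := sum_cyclic fun i j l => c i j l * c j l i
  have h5 := sum_cyclic fun i j l => c j l j * c i l i
  have h6 := Finset.sum_comm (s := Finset.univ) (t := Finset.univ) (f := fun i j => δ j i)
  have h7 : ∑ i, ∑ j, ∑ l, c j l i ^ 2 = ∑ i, ∑ j, ∑ l, c i l j ^ 2 := by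
    rw [Finset.sum_comm]
  have h8 : ∑ i, ∑ j, ∑ l, c i j l * c j l i = -∑ i, ∑ j, ∑ l, c i l j * c l i j := by
    rw [← Finset.sum_neg_distrib]
    refine Finset.sum_congr rfl fun i _ => ?_
    rw [Finset.sum_comm, ← Finset.sum_neg_distrib]
    refine Finset.sum_congr rfl fun j _ => ?_
    rw [← Finset.sum_neg_distrib]
    refine Finset.sum_congr rfl fun l _ => ?_
    rw [hc l j i, mul_neg]
  simp only [hquad, Finset.sum_add_distrib, Finset.sum_sub_distrib, Finset.sum_neg_distrib,
    ← Finset.mul_sum] at *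
  linarith

end Algebra

/-! ### Orthonormal frame formula and its behaviour under constant rescaling. -/

section Rescale

variable {n : ℕ} {M : Type*} [TopologicalSpace M] [ChartedSpace (EuclideanSpace ℝ (Fin n)) M]
  [IsManifold (𝓡 n) ∞ M] {ι : Type*} [Fintype ι] [DecidableEq ι]
  {g g' : SmoothMetric n M} {x₀ : M} {T : Set (EuclideanSpace ℝ (Fin n))}
  {ε : ι → EuclideanSpace ℝ (Fin n) → EuclideanSpace ℝ (Fin n)}
  {y : EuclideanSpace ℝ (Fin n)}

theorem chartBracketCoeff_antisymm {ι : Type*}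
    {ε : ι → EuclideanSpace ℝ (Fin n) → EuclideanSpace ℝ (Fin n)} (k a b : ι) :
    chartBracketCoeff g x₀ ε k a b y = -chartBracketCoeff g x₀ ε k b a y := by
  rw [chartBracketCoeff_eq_sub, chartBracketCoeff_eq_sub]
  ring

namespace IsChartFrame

theorem differentiableAt_chartBracketCoeff (h : IsChartFrame g x₀ T ε) (hy : y ∈ T) (k a b : ι) :
    DifferentiableAt ℝ (chartBracketCoeff g x₀ ε k a b) y := by
  have h1 : chartBracketCoeff g x₀ ε k a b
      = fun z => chartConnCoeff g x₀ ε k a b z - chartConnCoeff g x₀ ε k b a z :=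
    funext fun z => chartBracketCoeff_eq_sub g x₀ ε k a b z
  rw [h1]
  exact (h.differentiableAt_chartConnCoeff hy k a b).fun_sub
    (h.differentiableAt_chartConnCoeff hy k b a)

/-- The equality is needed on a neighbourhood because these coefficients get differentiated. -/
theorem chartConnCoeff_trace (h : IsChartFrame g x₀ T ε) (hy : y ∈ T) (i j : ι) :
    chartConnCoeff g x₀ ε i j j =ᶠ[𝓝 y] chartBracketCoeff g x₀ ε j i j := by
  filter_upwards [h.isOpen.mem_nhds hy] with z hz
  rw [h.chartConnCoeff_eq hz]
  linarith [chartBracketCoeff_antisymm (g := g) (x₀ := x₀) (ε := ε) (y := z) i j j,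
    chartBracketCoeff_antisymm (g := g) (x₀ := x₀) (ε := ε) (y := z) j i j]

theorem chartConnCoeff_left (h : IsChartFrame g x₀ T ε) (hy : y ∈ T) (i j : ι) :
    chartConnCoeff g x₀ ε i i j =ᶠ[𝓝 y] fun z => -chartBracketCoeff g x₀ ε i j i z := by
  filter_upwards [h.isOpen.mem_nhds hy] with z hz
  rw [h.chartConnCoeff_eq hz]
  linarith [chartBracketCoeff_antisymm (g := g) (x₀ := x₀) (ε := ε) (y := z) i i j,
    chartBracketCoeff_antisymm (g := g) (x₀ := x₀) (ε := ε) (y := z) j i i]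

/-- The scalar curvature in terms of the structure functions of an orthonormal frame. -/
theorem scalar_eq_chartBracketCoeff (h : IsChartFrame g x₀ T ε) (hy : y ∈ T) :
    ∑ j, ∑ k, (chartGram g x₀ y)⁻¹ j k * chartRicci g x₀ y (stdVec j) (stdVec k)
      = ∑ k, ∑ j, 2 * fderiv ℝ (chartBracketCoeff g x₀ ε j k j) y (ε k y)
        + ∑ i, ∑ j, ∑ k, (-(chartBracketCoeff g x₀ ε k i k y * chartBracketCoeff g x₀ ε j i j y)
          - 1 / 2 * (chartBracketCoeff g x₀ ε i k j y * chartBracketCoeff g x₀ ε k i j y)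
          - 1 / 4 * chartBracketCoeff g x₀ ε i k j y ^ 2) := by
  rw [h.scalar_eq hy, ← sum_koszul_eq (fun k i j => chartBracketCoeff g x₀ ε k i j y)
    (fun k i j => chartConnCoeff g x₀ ε k i j y)
    (fun k j => fderiv ℝ (chartBracketCoeff g x₀ ε j k j) y (ε k y))
    (fun k i j => chartBracketCoeff_antisymm k i j) (fun k i j => h.chartConnCoeff_eq hy k i j)]
  refine Finset.sum_congr rfl fun i _ => Finset.sum_congr rfl fun j _ => ?_
  rw [(h.chartConnCoeff_trace hy i j).fderiv_eq, (h.chartConnCoeff_left hy i j).fderiv_eq,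
    fderiv_fun_neg, neg_apply]

/-- Rescaling the members of an orthonormal frame yields an orthonormal frame of a metric for which
it is orthogonal. -/
theorem rescale (h : IsChartFrame g x₀ T ε) {s : ι → ℝ} (hs : ∀ a, s a ≠ 0)
    (hg' : ∀ y ∈ T, ∀ a b,
      chartMetric g' x₀ y (ε a y) (ε b y) = if a = b then (s a ^ 2)⁻¹ else 0) :
    IsChartFrame g' x₀ T fun a z => s a • ε a z where
  isOpen := h.isOpen
  subset := h.subset
  contDiffOn a := (h.contDiffOn a).const_smul (s a)
  orthonormal y hy a b := by
    have hB := isBilinearMap_chartMetric g' x₀ y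
    rw [hB.smul_left, hB.smul_right, hg' y hy]
    have := hs a
    split_ifs with hab
    · subst hab
      simp only [smul_eq_mul]
      field_simp
    · simp
  expansion y hy v := by
    let G := (isBilinearMap_chartMetric g' x₀ y).toLinearMap
    have ho : ∀ a b, G (ε a y) (ε b y) = if a = b then (s a ^ 2)⁻¹ else 0 := hg' y hy
    have hv := h.expansion y hy v
    have h1 : ∀ a, G v (ε a y) = chartMetric g x₀ y v (ε a y) * (s a ^ 2)⁻¹ := fun a => by
      conv_lhs => rw [hv]
      simp only [map_sum, map_smul, LinearMap.sum_apply, LinearMap.smul_apply, ho, smul_eq_mul]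
      simp
    refine hv.trans (Finset.sum_congr rfl fun a _ => ?_)
    change _ = (G v (s a • ε a y)) • _
    have := hs a
    rw [map_smul, h1, smul_smul]
    congr 1
    simp only [smul_eq_mul]
    field_simp

/-- Constants pull out of the bracket as s_a s_b; pairing with s_k ε_k under g' gives s_k · s_k⁻² =
1 / s_k. -/
theorem chartBracketCoeff_rescale (h : IsChartFrame g x₀ T ε) {s : ι → ℝ} (hs : ∀ a, s a ≠ 0)
    (hg' : ∀ y ∈ T, ∀ a b,
      chartMetric g' x₀ y (ε a y) (ε b y) = if a = b then (s a ^ 2)⁻¹ else 0)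
    (hy : y ∈ T) (k a b : ι) :
    chartBracketCoeff g' x₀ (fun a z => s a • ε a z) k a b y
      = s a * s b / s k * chartBracketCoeff g x₀ ε k a b y := by
  let G := (isBilinearMap_chartMetric g' x₀ y).toLinearMap
  have ho : ∀ a b, G (ε a y) (ε b y) = if a = b then (s a ^ 2)⁻¹ else 0 := hg' y hy
  have hexp : lieBracket ℝ (ε a) (ε b) y = ∑ l, chartBracketCoeff g x₀ ε l a b y • ε l y :=
    h.expansion y hy _
  have hbr : lieBracket ℝ (fun z => s a • ε a z) (fun z => s b • ε b z) y
      = (s a * s b) • lieBracket ℝ (ε a) (ε b) y := by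
    have h1 := lieBracket_const_smul_left (c := s a) (W := fun z => s b • ε b z)
      (h.differentiableAt hy a)
    have h2 := lieBracket_const_smul_right (c := s b) (V := ε a) (h.differentiableAt hy b)
    rw [mul_smul, ← h2]
    exact h1
  change G (lieBracket ℝ (fun z => s a • ε a z) (fun z => s b • ε b z) y) (s k • ε k y) = _
  rw [hbr, hexp]
  simp only [map_sum, map_smul, LinearMap.sum_apply, LinearMap.smul_apply, ho, smul_eq_mul]
  have := hs k
  simp only [mul_ite, mul_zero, Finset.sum_ite_eq', Finset.mem_univ, if_true]
  field_simp

/-- In the trace the factors s_j cancel, leaving one s_k from the coefficient and one from the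
direction. -/
theorem fderiv_chartBracketCoeff_rescale (h : IsChartFrame g x₀ T ε) {s : ι → ℝ}
    (hs : ∀ a, s a ≠ 0)
    (hg' : ∀ y ∈ T, ∀ a b,
      chartMetric g' x₀ y (ε a y) (ε b y) = if a = b then (s a ^ 2)⁻¹ else 0)
    (hy : y ∈ T) (k j : ι) :
    fderiv ℝ (chartBracketCoeff g' x₀ (fun a z => s a • ε a z) j k j) y (s k • ε k y)
      = s k ^ 2 * fderiv ℝ (chartBracketCoeff g x₀ ε j k j) y (ε k y) := by
  have hev : chartBracketCoeff g' x₀ (fun a z => s a • ε a z) j k j =ᶠ[𝓝 y]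
      fun z => s k * chartBracketCoeff g x₀ ε j k j z := by
    filter_upwards [h.isOpen.mem_nhds hy] with z hz
    rw [h.chartBracketCoeff_rescale hs hg' hz, mul_div_cancel_right₀ _ (hs j)]
  rw [hev.fderiv_eq, fderiv_const_mul (h.differentiableAt_chartBracketCoeff hy j k j), smul_apply,
    map_smul, smul_smul, smul_eq_mul, sq]

end IsChartFrame

end Rescale

theorem frameDeriv_congr {n : ℕ} {M : Type*} [TopologicalSpace M]
    [ChartedSpace (EuclideanSpace ℝ (Fin n)) M] {ι : Type*}
    {e : ι → (x : M) → TangentSpace (𝓡 n) x} (a : ι) {h h' : M → ℝ} {x : M} (hh : h =ᶠ[𝓝 x] h') :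
    frameDeriv e a h x = frameDeriv e a h' x :=
  congrArg (fun L : EuclideanSpace ℝ (Fin n) →L[ℝ] ℝ => L (e a x)) hh.mfderiv_eq

/-! ### Frame formulas on the manifold. -/

section FrameFormula

variable {n : ℕ} {M : Type*} [TopologicalSpace M] [ChartedSpace (EuclideanSpace ℝ (Fin n)) M]
  [IsManifold (𝓡 n) ∞ M] {ι : Type*} {g g' : SmoothMetric n M}
  {e : ι → (x : M) → TangentSpace (𝓡 n) x} {U : Set M}

theorem structureFunction_antisymm (he : IsLocalFrameOn (𝓡 n) (EuclideanSpace ℝ (Fin n)) ∞ e U)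
    (k i j : ι) (x : M) : structureFunction he k i j x = -structureFunction he k j i x := by
  rw [structureFunction, mlieBracket_swap_apply, map_neg]
  rfl

variable [Fintype ι] [DecidableEq ι]

theorem frameDeriv_structureFunction
    (he : IsLocalFrameOn (𝓡 n) (EuclideanSpace ℝ (Fin n)) ∞ e U)
    (ho : ∀ x ∈ U, ∀ a b, g.inner x (e a x) (e b x) = if a = b then 1 else 0) (hU : IsOpen U)
    {x : M} (hx : x ∈ U) (a k i j : ι) :
    frameDeriv e a (structureFunction he k i j) x
      = fderiv ℝ (chartBracketCoeff g x (fun a => chartField x (e a)) k i j)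
        (extChartAt (𝓡 n) x x) (chartField x (e a) (extChartAt (𝓡 n) x x)) :=
  frameDeriv_eq e a ((isChartFrame_chartField he ho hU x).differentiableAt_chartBracketCoeff
    ⟨mem_extChartAt_target x, by rwa [Set.mem_preimage, extChartAt_to_inv]⟩ k i j)
    (eventually_structureFunction_eq he ho hU hx k i j)

theorem frameDeriv_neg_structureFunction
    (he : IsLocalFrameOn (𝓡 n) (EuclideanSpace ℝ (Fin n)) ∞ e U)
    (ho : ∀ x ∈ U, ∀ a b, g.inner x (e a x) (e b x) = if a = b then 1 else 0) (hU : IsOpen U)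
    {x : M} (hx : x ∈ U) (a k i j : ι) :
    frameDeriv e a (fun z => -structureFunction he k i j z) x
      = -frameDeriv e a (structureFunction he k i j) x := by
  rw [← frameDeriv_congr a (Filter.Eventually.of_forall
    fun z => structureFunction_antisymm he k j i z),
    frameDeriv_structureFunction he ho hU hx, frameDeriv_structureFunction he ho hU hx,
    ← neg_apply, ← fderiv_fun_neg]
  congr 2
  funext z
  exact chartBracketCoeff_antisymm k j i

/-- The scalar curvature restricted to the span of some members of an orthonormal frame. -/
theorem restrictedScalarCurvature_eq {κ : Type*} [Fintype κ]
    (he : IsLocalFrameOn (𝓡 n) (EuclideanSpace ℝ (Fin n)) ∞ e U)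
    (ho : ∀ x ∈ U, ∀ a b, g.inner x (e a x) (e b x) = if a = b then 1 else 0) (hU : IsOpen U)
    {x : M} (hx : x ∈ U) (a : κ → ι) :
    restrictedScalarCurvature g he a x
      = ∑ k, ∑ j, 2 * frameDeriv e (a k) (structureFunction he (a j) (a k) (a j)) x
        + ∑ i, ∑ j, ∑ k, (-(structureFunction he (a k) (a i) (a k) x
            * structureFunction he (a j) (a i) (a j) x)
          - 1 / 2 * (structureFunction he (a i) (a k) (a j) x
            * structureFunction he (a k) (a i) (a j) x)
          - 1 / 4 * structureFunction he (a i) (a k) (a j) x ^ 2) := by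
  -- The Koszul formula is closed under selecting frame members, so the identity applies to the
  -- truncated sums defining D.
  rw [← sum_koszul_eq (fun k i j => structureFunction he (a k) (a i) (a j) x)
    (fun k i j => frameChristoffel g he (a k) (a i) (a j) x)
    (fun k j => frameDeriv e (a k) (structureFunction he (a j) (a k) (a j)) x)
    (fun k i j => structureFunction_antisymm he _ _ _ x)
    (fun k i j => frameChristoffel_eq he ho hU hx _ _ _)]
  refine Finset.sum_congr rfl fun i _ => Finset.sum_congr rfl fun j _ => ?_
  have h1 : frameChristoffel g he (a i) (a j) (a j)
      =ᶠ[𝓝 x] structureFunction he (a j) (a i) (a j) := by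
    filter_upwards [hU.mem_nhds hx] with z hz
    rw [frameChristoffel_eq he ho hU hz]
    linarith [structureFunction_antisymm he (a i) (a j) (a j) z,
      structureFunction_antisymm he (a j) (a i) (a j) z]
  have h2 : frameChristoffel g he (a i) (a i) (a j)
      =ᶠ[𝓝 x] fun z => -structureFunction he (a i) (a j) (a i) z := by
    filter_upwards [hU.mem_nhds hx] with z hz
    rw [frameChristoffel_eq he ho hU hz]
    linarith [structureFunction_antisymm he (a i) (a i) (a j) z,
      structureFunction_antisymm he (a j) (a i) (a i) z]
  rw [frameDeriv_congr (a i) h1, frameDeriv_congr (a j) h2,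
    frameDeriv_neg_structureFunction he ho hU hx]

/-- The scalar curvature of a metric `g'` for which a `g`-orthonormal frame is orthogonal, in terms
of the structure functions of that frame. -/
theorem scalarCurvature_eq (he : IsLocalFrameOn (𝓡 n) (EuclideanSpace ℝ (Fin n)) ∞ e U)
    (ho : ∀ x ∈ U, ∀ a b, g.inner x (e a x) (e b x) = if a = b then 1 else 0) (hU : IsOpen U)
    {s : ι → ℝ} (hs : ∀ a, s a ≠ 0)
    (hg' : ∀ x ∈ U, ∀ a b, g'.inner x (e a x) (e b x) = if a = b then (s a ^ 2)⁻¹ else 0)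
    {x : M} (hx : x ∈ U) :
    scalarCurvature g' x
      = ∑ k, ∑ j, 2 * (s k ^ 2 * frameDeriv e k (structureFunction he j k j) x)
        + ∑ i, ∑ j, ∑ k,
          (-(s i ^ 2 * (structureFunction he k i k x * structureFunction he j i j x))
          - 1 / 2 * (s j ^ 2 * (structureFunction he i k j x * structureFunction he k i j x))
          - 1 / 4 * ((s k * s j / s i) ^ 2 * structureFunction he i k j x ^ 2)) := by
  have hy := mem_extChartAt_target (I := 𝓡 n) x
  have hx' := extChartAt_to_inv (I := 𝓡 n) x
  have hyU : (extChartAt (𝓡 n) x).symm (extChartAt (𝓡 n) x x) ∈ U := by rwa [hx']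
  have hF := isChartFrame_chartField he ho hU x
  have hg'' : ∀ y ∈ (extChartAt (𝓡 n) x).target ∩ (extChartAt (𝓡 n) x).symm ⁻¹' U, ∀ a b,
      chartMetric g' x y (chartField x (e a) y) (chartField x (e b) y)
        = if a = b then (s a ^ 2)⁻¹ else 0 := fun y hy a b => by
    rw [chartMetric_chartField g' hy.1, hg' _ hy.2]
  have hC : ∀ k i j, structureFunction he k i j x
      = chartBracketCoeff g x (fun a => chartField x (e a)) k i j (extChartAt (𝓡 n) x x) :=
    fun k i j => by rw [← structureFunction_eq he ho hU hy hyU, hx']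
  have hmain := (hF.rescale hs hg'').scalar_eq_chartBracketCoeff (y := extChartAt (𝓡 n) x x)
    ⟨hy, hyU⟩
  simp only [hF.fderiv_chartBracketCoeff_rescale hs hg'' (y := extChartAt (𝓡 n) x x) ⟨hy, hyU⟩,
    hF.chartBracketCoeff_rescale hs hg'' (y := extChartAt (𝓡 n) x x) ⟨hy, hyU⟩, ← hC,
    ← frameDeriv_structureFunction he ho hU hx] at hmain
  refine Eq.trans hmain (congrArg _ ?_)
  refine Finset.sum_congr rfl fun i _ => Finset.sum_congr rfl fun j _ =>
    Finset.sum_congr rfl fun k _ => ?_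
  have hi := hs i
  have hj := hs j
  have hk := hs k
  field_simp

end FrameFormula

/-! ### Splitting the rescaled formula into blocks. -/

theorem sum_swap_inner {α β γ : Type*} [Fintype α] [Fintype β] [Fintype γ] (F : α → β → γ → ℝ) :
    ∑ a, ∑ b, ∑ c, F a b c = ∑ a, ∑ c, ∑ b, F a b c :=
  Finset.sum_congr rfl fun _ _ => Finset.sum_comm

theorem sum_rotate {α β γ : Type*} [Fintype α] [Fintype β] [Fintype γ] (F : α → β → γ → ℝ) :
    ∑ a, ∑ b, ∑ c, F a b c = ∑ c, ∑ a, ∑ b, F a b c := by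
  rw [sum_swap_inner, Finset.sum_comm]

/-- The frame formula for the scalar curvature, split into the contributions of the two blocks of a
frame which is rescaled by `f` on the second block. -/
theorem sum_rescaled_blocks {κ μ : Type*} [Fintype κ] [Fintype μ]
    (c : κ ⊕ μ → κ ⊕ μ → κ ⊕ μ → ℝ) (hc : ∀ k i j, c k i j = -c k j i)
    (δ : κ ⊕ μ → κ ⊕ μ → ℝ) {f : ℝ} (hf : f ≠ 0) (s : κ ⊕ μ → ℝ)
    (hsl : ∀ i, s (.inl i) = 1) (hsr : ∀ i, s (.inr i) = f) :
    ∑ k, ∑ j, 2 * (s k ^ 2 * δ k j) + ∑ i, ∑ j, ∑ k, (-(s i ^ 2 * (c k i k * c j i j))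
        - 1 / 2 * (s j ^ 2 * (c i k j * c k i j)) - 1 / 4 * ((s k * s j / s i) ^ 2 * c i k j ^ 2))
      = (∑ k, ∑ j, 2 * δ (.inl k) (.inl j)
        + ∑ i, ∑ j, ∑ k, (-(c (.inl k) (.inl i) (.inl k) * c (.inl j) (.inl i) (.inl j))
          - (1 / 2) * (c (.inl i) (.inl k) (.inl j) * c (.inl k) (.inl i) (.inl j))
          - (1 / 4) * c (.inl i) (.inl k) (.inl j) ^ 2))
      + f ^ 2 * (∑ γ, ∑ β, 2 * δ (.inr γ) (.inr β)
        + ∑ α, ∑ β, ∑ γ, (-(c (.inr γ) (.inr α) (.inr γ) * c (.inr β) (.inr α) (.inr β))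
          - (1 / 2) * (c (.inr α) (.inr γ) (.inr β) * c (.inr γ) (.inr α) (.inr β))
          - (1 / 4) * c (.inr α) (.inr γ) (.inr β) ^ 2))
      - (1 / 4) * f ^ 4 * ∑ i, ∑ γ, ∑ β, c (.inl i) (.inr γ) (.inr β) * c (.inl i) (.inr γ) (.inr β)
      + (2 * ∑ γ, ∑ j, δ (.inr γ) (.inl j)
          - ∑ α, ∑ k, ∑ j, c (.inl k) (.inr α) (.inl k) * c (.inl j) (.inr α) (.inl j)
          - 2 * ∑ α, ∑ k, ∑ β, c (.inl k) (.inr α) (.inl k) * c (.inr β) (.inr α) (.inr β)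
          - (1 / 2) * ∑ i, ∑ k, ∑ β, c (.inl k) (.inl i) (.inr β) * c (.inl i) (.inl k) (.inr β)
          - ∑ i, ∑ γ, ∑ β, c (.inl i) (.inr γ) (.inr β) * c (.inr γ) (.inl i) (.inr β)
          - (1 / 2) * ∑ i, ∑ γ, ∑ j, c (.inl i) (.inr γ) (.inl j) * c (.inl i) (.inr γ) (.inl j))
        * f ^ 2
      + (2 * ∑ k, ∑ β, δ (.inl k) (.inr β)
          - ∑ i, ∑ γ, ∑ β, c (.inr γ) (.inl i) (.inr γ) * c (.inr β) (.inl i) (.inr β)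
          - 2 * ∑ i, ∑ γ, ∑ j, c (.inr γ) (.inl i) (.inr γ) * c (.inl j) (.inl i) (.inl j)
          - (1 / 2) * ∑ α, ∑ γ, ∑ j, c (.inr α) (.inr γ) (.inl j) * c (.inr γ) (.inr α) (.inl j)
          - ∑ i, ∑ γ, ∑ j, c (.inl i) (.inr γ) (.inl j) * c (.inr γ) (.inl i) (.inl j)
          - (1 / 2) * ∑ α, ∑ k, ∑ β, c (.inr α) (.inl k) (.inr β) * c (.inr α) (.inl k) (.inr β))
      - (1 / 4) * (1 / f ^ 2)
        * ∑ α, ∑ k, ∑ j, c (.inr α) (.inl k) (.inl j) * c (.inr α) (.inl k) (.inl j) := by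
  -- These are the values of (s_k s_j / s_i)² with i in the Y-block and one, respectively both, of
  -- k, j there.
  have e1 : f ^ 2 / f ^ 2 = 1 := div_self (pow_ne_zero 2 hf)
  have e2 : (f ^ 2) ^ 2 / f ^ 2 = f ^ 2 := by rw [sq (f ^ 2), mul_self_div_self]
  simp only [Fintype.sum_sum_type, hsl, hsr, one_pow, one_mul, mul_one, div_one, mul_pow, e1, e2,
    div_pow, Finset.sum_add_distrib, Finset.sum_sub_distrib, Finset.sum_neg_distrib,
    ← Finset.mul_sum, ← Finset.sum_mul, ← sq]
  -- Summation orders are aligned so that equal mixed sums, which occur twice, become syntactically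
  -- equal; this turns 1/2 into 1 and 1/4 into 1/2.
  rw [Finset.sum_comm (s := Finset.univ) (t := Finset.univ) (f := fun i k =>
      ∑ β, c (.inl k) (.inl i) (.inr β) * c (.inl i) (.inl k) (.inr β)),
    sum_rotate fun (a : μ) (x : κ) (b : κ) => c (.inr a) (.inl b) (.inl x)
      * c (.inl b) (.inr a) (.inl x),
    sum_swap_inner fun (a : κ) (x : κ) (b : μ) => c (.inl a) (.inr b) (.inl x)
      * c (.inr b) (.inl a) (.inl x),
    sum_swap_inner fun (a : μ) (x : κ) (b : μ) => c (.inr a) (.inr b) (.inl x)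
      * c (.inr b) (.inr a) (.inl x),
    sum_swap_inner fun (a : κ) (x : μ) (b : κ) => c (.inl a) (.inl b) (.inr x)
      * c (.inl b) (.inl a) (.inr x),
    sum_rotate fun (a : μ) (x : μ) (b : κ) => c (.inr a) (.inl b) (.inr x)
      * c (.inl b) (.inr a) (.inr x),
    sum_swap_inner fun (a : κ) (x : μ) (b : μ) => c (.inl a) (.inr b) (.inr x)
      * c (.inr b) (.inl a) (.inr x),
    sum_swap_inner fun (a : μ) (x : κ) (b : κ) => c (.inr a) (.inl b) (.inl x) ^ 2,
    sum_swap_inner fun (a : μ) (x : μ) (b : κ) => c (.inr a) (.inl b) (.inr x) ^ 2,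
    sum_swap_inner fun (a : κ) (x : κ) (b : μ) => c (.inl a) (.inr b) (.inl x) ^ 2,
    sum_swap_inner fun (a : κ) (x : μ) (b : μ) => c (.inl a) (.inr b) (.inr x) ^ 2]
  -- Antisymmetry fixes the order of mixed lower indices, the signs cancelling in pairs. Squaring
  -- the trace over both blocks gives the mixed trace products their coefficient 2.
  simp only [mul_comm (c (.inr _) (.inl _) _) (c (.inl _) (.inr _) _),
    hc (.inl _) (.inl _) (.inr _), hc (.inr _) (.inr _) (.inl _), neg_sq, neg_mul_neg, add_sq,
    Finset.sum_add_distrib, mul_assoc, ← Finset.mul_sum]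
  simp only [mul_comm (∑ j, c (.inr j) (.inl _) (.inr j))]
  ring

end SubbundleScalar

end

/-! ### Assembly for the split metric. -/

theorem theorem3p4 {n r s : ℕ} {M : Type*} [TopologicalSpace M]
    [ChartedSpace (EuclideanSpace ℝ (Fin n)) M] [IsManifold (𝓡 n) ∞ M]
    (g g' : SubbundleScalar.SmoothMetric n M)
    (X Y : (x : M) → Submodule ℝ (TangentSpace (𝓡 n) x))
    (hXY : SubbundleScalar.IsOrthogonalSplitting g X Y r s)
    (f : ℝ) (hf : 0 < f) (hg' : SubbundleScalar.IsRescaledMetric g X Y f g')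
    (U : Set M) (hU : IsOpen U) (e : Fin r ⊕ Fin s → (x : M) → TangentSpace (𝓡 n) x)
    (he : SubbundleScalar.IsAdaptedOrthonormalFrame g X Y e U)
    (c : Fin r ⊕ Fin s → Fin r ⊕ Fin s → Fin r ⊕ Fin s → M → ℝ)
    (hc : c = SubbundleScalar.structureFunction he.isLocalFrameOn) (x : M) (hx : x ∈ U) :
    (SubbundleScalar.scalarCurvature g' x
      = SubbundleScalar.restrictedScalarCurvature g he.isLocalFrameOn Sum.inl x
      + f ^ 2 * SubbundleScalar.restrictedScalarCurvature g he.isLocalFrameOn Sum.inr x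
      - (1 / 4) * f ^ 4 * ∑ i, ∑ γ, ∑ β, c (.inl i) (.inr γ) (.inr β) x * c (.inl i) (.inr γ) (.inr β) x
      + (2 * ∑ γ, ∑ j, SubbundleScalar.frameDeriv e (.inr γ) (c (.inl j) (.inr γ) (.inl j)) x
          - ∑ α, ∑ k, ∑ j, c (.inl k) (.inr α) (.inl k) x * c (.inl j) (.inr α) (.inl j) x
          - 2 * ∑ α, ∑ k, ∑ β, c (.inl k) (.inr α) (.inl k) x * c (.inr β) (.inr α) (.inr β) x
          - (1 / 2) * ∑ i, ∑ k, ∑ β, c (.inl k) (.inl i) (.inr β) x * c (.inl i) (.inl k) (.inr β) x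
          - ∑ i, ∑ γ, ∑ β, c (.inl i) (.inr γ) (.inr β) x * c (.inr γ) (.inl i) (.inr β) x
          - (1 / 2) * ∑ i, ∑ γ, ∑ j, c (.inl i) (.inr γ) (.inl j) x * c (.inl i) (.inr γ) (.inl j) x) * f ^ 2
      + (2 * ∑ k, ∑ β, SubbundleScalar.frameDeriv e (.inl k) (c (.inr β) (.inl k) (.inr β)) x
          - ∑ i, ∑ γ, ∑ β, c (.inr γ) (.inl i) (.inr γ) x * c (.inr β) (.inl i) (.inr β) x
          - 2 * ∑ i, ∑ γ, ∑ j, c (.inr γ) (.inl i) (.inr γ) x * c (.inl j) (.inl i) (.inl j) x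
          - (1 / 2) * ∑ α, ∑ γ, ∑ j, c (.inr α) (.inr γ) (.inl j) x * c (.inr γ) (.inr α) (.inl j) x
          - ∑ i, ∑ γ, ∑ j, c (.inl i) (.inr γ) (.inl j) x * c (.inr γ) (.inl i) (.inl j) x
          - (1 / 2) * ∑ α, ∑ k, ∑ β, c (.inr α) (.inl k) (.inr β) x * c (.inr α) (.inl k) (.inr β) x)
      - (1 / 4) * (1 / f ^ 2) * ∑ α, ∑ k, ∑ j, c (.inr α) (.inl k) (.inl j) x * c (.inr α) (.inl k) (.inl j) x) ∧
    (SubbundleScalar.restrictedScalarCurvature g he.isLocalFrameOn Sum.inl x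
      = ∑ k, ∑ j, 2 * SubbundleScalar.frameDeriv e (.inl k) (c (.inl j) (.inl k) (.inl j)) x
      + ∑ i, ∑ j, ∑ k, (- (c (.inl k) (.inl i) (.inl k) x * c (.inl j) (.inl i) (.inl j) x)
          - (1 / 2) * (c (.inl i) (.inl k) (.inl j) x * c (.inl k) (.inl i) (.inl j) x)
          - (1 / 4) * c (.inl i) (.inl k) (.inl j) x ^ 2)) ∧
    (SubbundleScalar.restrictedScalarCurvature g he.isLocalFrameOn Sum.inr x
      = ∑ γ, ∑ β, 2 * SubbundleScalar.frameDeriv e (.inr γ) (c (.inr β) (.inr γ) (.inr β)) x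
      + ∑ α, ∑ β, ∑ γ, (- (c (.inr γ) (.inr α) (.inr γ) x * c (.inr β) (.inr α) (.inr β) x)
          - (1 / 2) * (c (.inr α) (.inr γ) (.inr β) x * c (.inr γ) (.inr α) (.inr β) x)
          - (1 / 4) * c (.inr α) (.inr γ) (.inr β) x ^ 2)) := by
  have ho := he.orthonormal
  have hf0 : f ≠ 0 := hf.ne'
  -- Weights 1 on X and f on Y: since g'(e_α, e_α) = f⁻², the field f e_α has unit length for g'.
  have hs : ∀ a : Fin r ⊕ Fin s, Sum.elim (fun _ => 1) (fun _ => f) a ≠ 0 := by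
    rintro (i | α) <;> simp [hf0]
  have hF : ∀ x ∈ U, ∀ a b, g'.inner x (e a x) (e b x)
      = if a = b then (Sum.elim (fun _ => 1) (fun _ => f) a ^ 2)⁻¹ else 0 := by
    rintro x hx (i | α) (j | β)
    · rw [hg'.left x _ (he.mem_left x hx i) _ (he.mem_left x hx j), ho x hx]
      simp
    · rw [hg'.mixed x _ (he.mem_left x hx i) _ (he.mem_right x hx β)]
      simp
    · rw [g'.symm, hg'.mixed x _ (he.mem_left x hx j) _ (he.mem_right x hx α)]
      simp
    · rw [hg'.right x _ (he.mem_right x hx α) _ (he.mem_right x hx β), ho x hx]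
      simp
  have hl := SubbundleScalar.restrictedScalarCurvature_eq he.isLocalFrameOn ho hU hx Sum.inl
  have hr := SubbundleScalar.restrictedScalarCurvature_eq he.isLocalFrameOn ho hU hx Sum.inr
  subst hc
  refine ⟨?_, hl, hr⟩
  rw [hl, hr, SubbundleScalar.scalarCurvature_eq he.isLocalFrameOn ho hU hs hF hx]
  exact SubbundleScalar.sum_rescaled_blocks
    (fun k i j => SubbundleScalar.structureFunction he.isLocalFrameOn k i j x)
    (fun k i j => SubbundleScalar.structureFunction_antisymm he.isLocalFrameOn k i j x)
    (fun k j => SubbundleScalar.frameDeriv e k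
      (SubbundleScalar.structureFunction he.isLocalFrameOn j k j) x) hf0 _ (fun _ => rfl)
    (fun _ => rfl)
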